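/- Let $G$ be a finite simple graph, $\{u,v\}$ an edge of $G$ with $\deg(u)\le\deg(v)$, and $\mathrm{dist}$ the shortest-path distance. For a node $x$ let $N(x)$ be its set of neighbours and $N[x]=N(x)\cup\{x\}$. **Curvature.** The Ollivier–Ricci curvature of the edge is $\mathfrak C_G(u,v)=1-\mathrm{EMD}$, where $\mathrm{EMD}$ is the minimum of $\sum_{x\in N[u]}\sum_{y\in N[v]}\mathrm{dist}(x,y)\,z_{x,y}$ over all $z\ge 0$ with $\sum_{y}z_{x,y}=\frac1{1+\deg(u)}$ for each $x\in N[u]$ and $\sum_{x}z_{x,y}=\frac1{1+\deg(v)}$ for each $y\in N[v]$. A number $c$ is an additive $r$-approximation of $\mathfrak C_G(u,v)$ if $\mathrm{EMD}\le 1-c\le \mathrm{EMD}+r$. **Graphs.** We use three complete bipartite graphs with integer edge weights: - $G_{u,v}$ has sides $N[u]$, $N[v]$ and weights $\mathrm{dist}(x,y)$. - $G'_{u,v}$ is obtained as follows: write $\deg(v)+1=a(\deg(u)+1)+b$ with $0\le b<\deg(u)+1$. Its left side consists of $a$ copies of every node of $N[u]$ and $b$ special nodes, its right side is $N[v]$.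 Copies inherit the weights of $G_{u,v}$, and all edges at special nodes have weight $3$. - $H$ has sides $L=N(u)\setminus(N(v)\cup\{v\})$, $R=N(v)\setminus(N(u)\cup\{u\})$ and weights $\mathrm{dist}(x,y)$. For such a graph $F$, $\deg_{F,j}(x)$ is the number of edges of weight $j$ at the node $x$. **Queries.** A weighted neighbour query $(x,s)$ on $F$ returns a uniformly random node among those nodes $z$ with $w(x,z)=s$ that have not been returned by earlier queries $(x,s)$, or a special symbol if there is none. A local algorithm may draw uniformly random nodes from either side of $F$, make weighted neighbour queries on $F$, recognize nodes seen before, and compute with the numbers $\deg(u)$, $\deg(v)$, $|N(u)\cap N(v)|$. Its program does not depend on $G$. Every draw, every query and every comparison is one instruction. **Claim.** Let $d\in\mathbb N$ and $\varepsilon,\delta>0$ be constants. Below, "admissible" means: $G$ is any finite graph, $\{u,v\}$ an edge with $\deg(u)\le\deg(v)$ and $\deg(u)\ge(1-\delta/3)\deg(v)$. 0. For each $j\in\{1,2\}$ there are a constant $D$ and a local algorithm using weighted neighbour queries for the weight $j$ only such that, for every admissible $(G,u,v)$ with $\max_x\deg_{G_{u,v},j}(x)\le d$: $\max_x\deg_{G'_{u,v},j}(x)\le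 D$, and, given any node $x$ of $G'_{u,v}$, the algorithm run on $G'_{u,v}$ always outputs $\deg_{G'_{u,v},j}(x)$ after at most $D$ instructions (a selective degree query is simulated by $O(1)$ weighted neighbour queries). 1. There are a constant $T$ and a local algorithm such that, for every admissible $(G,u,v)$ with $\max_x\deg_{H,1}(x)\le d$, the algorithm run on $H$ always stops after at most $T$ instructions (hence at most $T$ weighted neighbour queries), and with probability at least $2/3$ its output is an additive $(1+\varepsilon+\delta)$-approximation of $\mathfrak C_G(u,v)$. 2. There are a constant $T$ and a local algorithm such that, for every admissible $(G,u,v)$ with $\max_x\deg_{H,1}(x)\le d$ and $\max_x\deg_{H,2}(x)\le d$, the algorithm run on $H$ always stops after at most $T$ instructions, and with probability at least $2/3$ its output is an additive $(\tfrac12+\varepsilon+\delta)$-approximation of $\mathfrak C_G(u,v)$. The constants and programs depend only on $d,\varepsilon,\delta$ (and $j$). -/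

import Mathlib

universe w

noncomputable section

namespace RicciQuery

/-! ### Earth mover's distance and Ollivier-Ricci curvature -/

/-- Feasible solutions of the transportation linear program between `P` and `Q`. -/
def IsTransportPlan {A B : Type*} [Fintype A] [Fintype B]
    (P : A → ℝ) (Q : B → ℝ) (z : A → B → ℝ) : Prop :=
  (∀ x, ∑ y, z x y = P x) ∧ (∀ y, ∑ x, z x y = Q y) ∧ ∀ x y, 0 ≤ z x y

/-- Earth mover's distance over the complete bipartite graph with sides `A`, `B` and edge
weights `w`: the optimal value of the transportation linear program. -/
def emd {A B : Type*} [Fintype A] [Fintype B]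
    (w : A → B → ℝ) (P : A → ℝ) (Q : B → ℝ) : ℝ :=
  sInf {c : ℝ | ∃ z : A → B → ℝ, IsTransportPlan P Q z ∧ c = ∑ x, ∑ y, w x y * z x y}

section Graph

variable {V : Type*} [Fintype V] [DecidableEq V] (G : SimpleGraph V) [DecidableRel G.Adj]

/-- The closed neighbourhood `{x} ∪ Nbr(x)`, as a type. -/
abbrev ClosedNbr (x : V) : Type _ := {y : V // y ∈ insert x (G.neighborFinset x)}

/-- Edge weights of the complete bipartite graph `G_{u,v}`. -/
def guvWeight (u v : V) (x : ClosedNbr G u) (y : ClosedNbr G v) : ℕ := G.dist x.1 y.1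

/-- Ollivier-Ricci curvature of the edge `{u, v}`. -/
def curvature (u v : V) : ℝ :=
  1 - emd (fun (x : ClosedNbr G u) (y : ClosedNbr G v) => (guvWeight G u v x y : ℝ))
    (fun _ => 1 / (1 + (G.degree u : ℝ))) (fun _ => 1 / (1 + (G.degree v : ℝ)))

/-- `c` is an additive `r`-approximation of the curvature of `{u, v}`: the number `1 - c` is an
additive `r`-approximation `EMD ≤ 1 - c ≤ EMD + r` of the underlying minimization problem. -/
def IsAdditiveApprox (u v : V) (r c : ℝ) : Prop :=
  1 - curvature G u v ≤ 1 - c ∧ 1 - c ≤ (1 - curvature G u v) + r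

/-- The left side `Nbr(u) \ (Nbr(v) ∪ {v})` of the complete bipartite graph `H`. -/
abbrev HLeft (u v : V) : Type _ :=
  {x : V // x ∈ G.neighborFinset u \ (G.neighborFinset v ∪ {v})}

/-- The right side `Nbr(v) \ (Nbr(u) ∪ {u})` of the complete bipartite graph `H`. -/
abbrev HRight (u v : V) : Type _ :=
  {y : V // y ∈ G.neighborFinset v \ (G.neighborFinset u ∪ {u})}

/-- Edge weights of `H`. -/
def hWeight (u v : V) (x : HLeft G u v) (y : HRight G u v) : ℕ := G.dist x.1 y.1

/-- The left side of the balanced graph `G'_{u,v}`: writing `deg v + 1 = a (deg u + 1) + b` with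
`0 ≤ b < deg u + 1`, it has `a` copies of each node of the closed neighbourhood of `u`, and `b`
special nodes. The right side is the closed neighbourhood of `v`. -/
abbrev BalancedLeft (u v : V) : Type _ :=
  (ClosedNbr G u × Fin ((G.degree v + 1) / (G.degree u + 1))) ⊕
    Fin ((G.degree v + 1) % (G.degree u + 1))

/-- Edge weights of `G'_{u,v}`: copies inherit distances, special nodes have weight `3`. -/
def balancedWeight (u v : V) : BalancedLeft G u v → ClosedNbr G v → ℕ
  | Sum.inl (x, _), y => G.dist x.1 y.1
  | Sum.inr _, _ => 3

/-- The numbers known to a local algorithm from the two neighbour lists: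
`deg u`, `deg v`, and the number of common neighbours. -/
def knownNumbers (u v : V) : Fin 3 → ℚ :=
  ![(G.degree u : ℚ), (G.degree v : ℚ),
    ((G.neighborFinset u ∩ G.neighborFinset v).card : ℚ)]

end Graph

/-! ### Edge-weighted complete bipartite graphs

Such a graph is a function `w : A → B → ℕ`; its node set is `A ⊕ B`. -/

section Bipartite

variable {A B : Type*} [Fintype A] [Fintype B]

/-- The nodes joined to a given node by an edge of weight `s`. -/
def wNbrs (w : A → B → ℕ) : A ⊕ B → ℕ → Finset (A ⊕ B)
  | Sum.inl a, s => (Finset.univ.filter fun b => w a b = s).map Function.Embedding.inr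
  | Sum.inr b, s => (Finset.univ.filter fun a => w a b = s).map Function.Embedding.inl

/-- The number of edges of weight `s` incident on a node. -/
def wDeg (w : A → B → ℕ) (x : A ⊕ B) (s : ℕ) : ℕ := (wNbrs w x s).card

end Bipartite

/-! ### Local algorithms with weighted neighbour queries -/

/-- Arithmetic expressions in the numbers known to the algorithm. -/
inductive Expr : Type
  | const (q : ℚ)
  | var (i : Fin 3)
  | add (e f : Expr)
  | sub (e f : Expr)
  | mul (e f : Expr)
  | div (e f : Expr)

/-- Value of an expression. -/
def Expr.eval (env : Fin 3 → ℚ) : Expr → ℚ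
  | .const q => q
  | .var i => env i
  | .add e f => e.eval env + f.eval env
  | .sub e f => e.eval env - f.eval env
  | .mul e f => e.eval env * f.eval env
  | .div e f => e.eval env / f.eval env

/-- A local algorithm. It refers to nodes by their number in the order of discovery; whenever a
node is returned, the algorithm learns this number, so that it recognizes nodes seen before.
The program does not depend on the graph, and as long as it executes at most `T` instructions,
all the numbers it sees are less than `T` plus the number of initially known nodes, so that only a
finite decision tree is ever used.
* `output e` stops with the value of `e`;
* `ifLe e f p q` continues with `p` if the value of `e` is at most that of `f`, else with `q`;
* `sampleLeft k` and `sampleRight k` draw a uniformly random node of one side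
  (`none` if that side is empty);
* `query i s k` is the weighted neighbour query at node number `i` for the weight `s`. -/
inductive Prog : Type
  | output (e : Expr)
  | ifLe (e f : Expr) (p q : Prog)
  | sampleLeft (k : Option ℕ → Prog)
  | sampleRight (k : Option ℕ → Prog)
  | query (i s : ℕ) (k : Option ℕ → Prog)

/-- All queries of the program are for weight `s`. -/
def Prog.OnlyWeight (s : ℕ) : Prog → Prop
  | .output _ => True
  | .ifLe _ _ p q => p.OnlyWeight s ∧ q.OnlyWeight s
  | .sampleLeft k => ∀ o, (k o).OnlyWeight s
  | .sampleRight k => ∀ o, (k o).OnlyWeight s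
  | .query _ t k => t = s ∧ ∀ o, (k o).OnlyWeight s

/-- State of a run: the nodes discovered so far, in order of discovery, and for every node `x` and
weight `s` the set of nodes already returned by queries `(x, s)`. -/
structure State (X : Type*) where
  seen : List X
  answered : X → ℕ → Finset X

/-- Initial state, in which the nodes in a given list are known. -/
def State.init {X : Type*} (l : List X) : State X := ⟨l, fun _ _ => ∅⟩

section Run

variable {X : Type*} [DecidableEq X]

/-- Add a node to the list of discovered nodes. -/
def State.discover (σ : State X) : Option X → State X
  | none => σ
  | some z => ⟨if z ∈ σ.seen then σ.seen else σ.seen ++ [z], σ.answered⟩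

/-- Number of a node in the order of discovery (a new node gets the next free number). -/
def State.number (σ : State X) : Option X → Option ℕ
  | none => none
  | some z => some (σ.seen.idxOf z)

/-- Record that `z` was returned by a query for weight `s` at node number `i`. -/
def State.record (σ : State X) (i s : ℕ) : Option X → State X
  | none => σ
  | some z =>
    ⟨σ.seen, fun x t =>
      if σ.seen[i]? = some x ∧ t = s then insert z (σ.answered x t) else σ.answered x t⟩

/-- A uniformly random element of a finite set; the special symbol `none` if it is empty. -/
def draw (S : Finset X) : PMF (Option X) :=
  if h : S.Nonempty then (PMF.uniformOfFinset S h).map some else PMF.pure none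

end Run

section Semantics

variable {A B : Type*} [Fintype A] [Fintype B] [DecidableEq A] [DecidableEq B]

/-- Possible answers to the weighted neighbour query at node number `i` for the weight `s`: the
nodes `z` with `w(x, z) = s`, `x` being that node, not yet returned by queries `(x, s)`. -/
def answers (w : A → B → ℕ) (σ : State (A ⊕ B)) (i s : ℕ) : Finset (A ⊕ B) :=
  match σ.seen[i]? with
  | none => ∅
  | some x => wNbrs w x s \ σ.answered x s

/-- Count one more instruction. -/
def tick (o : ℚ × ℕ) : ℚ × ℕ := (o.1, o.2 + 1)

/-- Distribution of the pair (output, number of executed instructions) of a program on the graph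
`w`. Every query is an instruction, so the second entry bounds the number of queries. -/
def Prog.run (w : A → B → ℕ) (env : Fin 3 → ℚ) : Prog → State (A ⊕ B) → PMF (ℚ × ℕ)
  | .output e, _ => PMF.pure (e.eval env, 0)
  | .ifLe e f p q, σ =>
    (if e.eval env ≤ f.eval env then p.run w env σ else q.run w env σ).map tick
  | .sampleLeft k, σ =>
    (draw (Finset.univ.map Function.Embedding.inl)).bind fun o =>
      ((k (σ.number o)).run w env (σ.discover o)).map tick
  | .sampleRight k, σ =>
    (draw (Finset.univ.map Function.Embedding.inr)).bind fun o =>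
      ((k (σ.number o)).run w env (σ.discover o)).map tick
  | .query i s k, σ =>
    (draw (answers w σ i s)).bind fun o =>
      ((k (σ.number o)).run w env ((σ.record i s o).discover o)).map tick

end Semantics

/-- The local algorithm `p`, run on the graph `H` of the edge `{u, v}`, always executes at most
`T` instructions (in particular makes at most `T` queries), and with probability at least `2/3`
its output is an additive `r`-approximation of the curvature of `{u, v}`. -/
def Prog.Approximates {V : Type*} [Fintype V] [DecidableEq V] (p : Prog)
    (G : SimpleGraph V) [DecidableRel G.Adj] (u v : V) (T : ℕ) (r : ℝ) : Prop :=
  (∀ o ∈ (p.run (hWeight G u v) (knownNumbers G u v) (State.init [])).support, o.2 ≤ T) ∧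
  2 / 3 ≤ (p.run (hWeight G u v) (knownNumbers G u v) (State.init [])).toOuterMeasure
    {o | IsAdditiveApprox G u v r (o.1 : ℝ)}

end RicciQuery

end

/-! Put `n = 1 + deg v`. Distances between `N[u]` and `N[v]` are at most 3, and mass on common nodes
can stay in place. Moving the rest at cost 3 costs `3|R|/n`, and each unit that a fractional
matching of `H` puts on an edge of weight `s` saves `(3 - s)/n`. So a matching of gain `X` gives
`EMD ≤ (3|R| - X)/n` (`one_sub_curvature_le`). Conversely, nonnegative prices `y` with `K - y_l -
y_r ≤ dist(l, r)` on `H` yield a 1-Lipschitz potential, whence `EMD ≥ (K|R| - ∑ y)/n - K (deg v -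
deg u)/n` (`le_one_sub_curvature`); for `K ≤ 3` the last term is at most `δ`.

Maximal gain on the edges with weights in `S` is dual to minimal total price subject to `y_l + y_r ≥
3 - s`. For `S = {1, 2}` the prices work with `K = 3`, since weight 3 has no gain, and the two
bounds nearly meet. For `S = {1}` half the prices work with `K = 2`, which loses at most 1.

A nearly optimal matching is found locally (`exists_dual_of_localGain`). Run `T` subgradient steps
on the penalised dual, starting from zero prices. The averaged indicator of violated edges is an
almost feasible flow, and dividing it by the loads makes it a matching. Comparing with the prices 2
on overloaded nodes, the regret bound pays for the loss in this division.

When the degrees for the weights in `S` are bounded, `T` is constant and the gain at a node depends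
only on a ball of radius `T + 2` (`CorrectTable.localGain_eq`). The algorithm samples constantly
many left nodes, explores around them (`outputs_estimate`) and averages; Chebyshev's inequality
(`two_thirds_le_avgList`) bounds the error.

For the balanced graph, a degree bound for weight 1 or 2 forces boundedly many copies (`copies_le`),
and a bounded degree is counted by repeating one query. -/

noncomputable section

namespace RicciQuery

/-! ### A local subgradient method for fractional matchings

`nb v s` is the set of nodes joined to `v` by an edge of weight `s`; only the weights in `S` are
used, and an edge of weight `s` has the gain `3 - s`. -/

section Dynamics

variable {X : Type*} (S : Finset ℕ) (nb : X → ℕ → Finset X) (η : ℚ) (T : ℕ)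

/-- Sum of a function over the edges at a node. -/
def edgeSum (v : X) (F : X → ℕ → ℚ) : ℚ := ∑ s ∈ S, ∑ u ∈ nb v s, F u s

/-- The edges violating the dual constraint for the prices `y`. -/
def violated (y : X → ℚ) (v u : X) (s : ℕ) : ℚ := if y v + y u < 3 - s then 1 else 0

/-- Iterates of the projected subgradient method for the dual linear program. -/
def price : ℕ → X → ℚ
  | 0, _ => 0
  | t + 1, v => max 0 (price t v - η * (1 - edgeSum S nb v (violated (price t) v)))

/-- Average of the primal subgradients. -/
def avgFlow (v u : X) (s : ℕ) : ℚ := (∑ t ∈ Finset.range T, violated (price S nb η t) v u s) / T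

def avgLoad (v : X) : ℚ := edgeSum S nb v (avgFlow S nb η T v)

/-- The average flow, scaled down to a fractional matching. -/
def scaledFlow (v u : X) (s : ℕ) : ℚ :=
  avgFlow S nb η T v u s / (max 1 (avgLoad S nb η T v) * max 1 (avgLoad S nb η T u))

def localGain (v : X) : ℚ := edgeSum S nb v fun u s => (3 - s) * scaledFlow S nb η T v u s

end Dynamics

/-! ### Regret analysis of the subgradient method -/

section Analysis

variable {X : Type*} {S : Finset ℕ} {nb : X → ℕ → Finset X} {η : ℚ} {T : ℕ}

lemma edgeSum_le {v : X} {F F' : X → ℕ → ℚ} (h : ∀ s ∈ S, ∀ u ∈ nb v s, F u s ≤ F' u s) :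
    edgeSum S nb v F ≤ edgeSum S nb v F' :=
  Finset.sum_le_sum fun s hs => Finset.sum_le_sum fun u hu => h s hs u hu

lemma edgeSum_congr {v : X} {F F' : X → ℕ → ℚ} (h : ∀ s ∈ S, ∀ u ∈ nb v s, F u s = F' u s) :
    edgeSum S nb v F = edgeSum S nb v F' :=
  Finset.sum_congr rfl fun s hs => Finset.sum_congr rfl fun u hu => h s hs u hu

lemma edgeSum_nonneg {v : X} {F : X → ℕ → ℚ} (h : ∀ s ∈ S, ∀ u ∈ nb v s, 0 ≤ F u s) :
    0 ≤ edgeSum S nb v F :=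
  Finset.sum_nonneg fun s hs => Finset.sum_nonneg fun u hu => h s hs u hu

lemma edgeSum_add (v : X) (F F' : X → ℕ → ℚ) :
    edgeSum S nb v (fun u s => F u s + F' u s) = edgeSum S nb v F + edgeSum S nb v F' := by
  simp [edgeSum, Finset.sum_add_distrib]

lemma edgeSum_sub (v : X) (F F' : X → ℕ → ℚ) :
    edgeSum S nb v (fun u s => F u s - F' u s) = edgeSum S nb v F - edgeSum S nb v F' := by
  simp [edgeSum, Finset.sum_sub_distrib]

lemma edgeSum_mul_left (v : X) (c : ℚ) (F : X → ℕ → ℚ) :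
    edgeSum S nb v (fun u s => c * F u s) = c * edgeSum S nb v F := by
  simp [edgeSum, Finset.mul_sum]

lemma edgeSum_mul_right (v : X) (c : ℚ) (F : X → ℕ → ℚ) :
    edgeSum S nb v (fun u s => F u s * c) = edgeSum S nb v F * c := by
  simp [edgeSum, Finset.sum_mul]

lemma edgeSum_sum {ι : Type*} (v : X) (I : Finset ι) (F : ι → X → ℕ → ℚ) :
    edgeSum S nb v (fun u s => ∑ t ∈ I, F t u s) = ∑ t ∈ I, edgeSum S nb v (F t) := by
  simp only [edgeSum]
  rw [Finset.sum_comm]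
  exact Finset.sum_congr rfl fun s _ => Finset.sum_comm

lemma violated_comm (y : X → ℚ) (v u : X) (s : ℕ) : violated y v u s = violated y u v s := by
  simp [violated, add_comm]

lemma violated_nonneg (y : X → ℚ) (v u : X) (s : ℕ) : 0 ≤ violated y v u s := by
  unfold violated; split_ifs <;> norm_num

lemma violated_le_one (y : X → ℚ) (v u : X) (s : ℕ) : violated y v u s ≤ 1 := by
  unfold violated; split_ifs <;> norm_num

lemma violated_mul (y : X → ℚ) (v u : X) (s : ℕ) :
    max 0 (3 - s - y v - y u) = violated y v u s * (3 - s - y v - y u) := by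
  unfold violated
  split_ifs with h
  · rw [max_eq_right (by linarith), one_mul]
  · rw [max_eq_left (by linarith), zero_mul]

lemma price_nonneg (t : ℕ) (v : X) : 0 ≤ price S nb η t v := by
  cases t with
  | zero => exact le_rfl
  | succ t => exact le_max_left _ _

lemma avgFlow_comm (v u : X) (s : ℕ) : avgFlow S nb η T v u s = avgFlow S nb η T u v s := by
  simp only [avgFlow, violated_comm _ v u s]

lemma avgFlow_nonneg (v u : X) (s : ℕ) : 0 ≤ avgFlow S nb η T v u s :=
  div_nonneg (Finset.sum_nonneg fun _ _ => violated_nonneg _ _ _ _) (Nat.cast_nonneg _)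

lemma scaledFlow_comm (v u : X) (s : ℕ) :
    scaledFlow S nb η T v u s = scaledFlow S nb η T u v s := by
  simp only [scaledFlow, avgFlow_comm v u s, mul_comm]

lemma scaledFlow_nonneg (v u : X) (s : ℕ) : 0 ≤ scaledFlow S nb η T v u s :=
  div_nonneg (avgFlow_nonneg _ _ _) (by positivity)

/-- Division by the load of `v` alone suffices; the factor of the other end only shrinks the flow
further. -/
lemma edgeSum_scaledFlow_le_one (v : X) : edgeSum S nb v (scaledFlow S nb η T v) ≤ 1 := by
  have h1 : edgeSum S nb v (scaledFlow S nb η T v) ≤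
      edgeSum S nb v (fun u s => avgFlow S nb η T v u s * (max 1 (avgLoad S nb η T v))⁻¹) := by
    refine edgeSum_le fun s _ u _ => ?_
    have ha : (1 : ℚ) ≤ max 1 (avgLoad S nb η T v) := le_max_left _ _
    have hb : (1 : ℚ) ≤ max 1 (avgLoad S nb η T u) := le_max_left _ _
    rw [scaledFlow, div_eq_mul_inv]
    refine mul_le_mul_of_nonneg_left (inv_anti₀ (by linarith) ?_) (avgFlow_nonneg _ _ _)
    nlinarith
  rw [edgeSum_mul_right, ← div_eq_mul_inv] at h1
  refine h1.trans (div_le_one_of_le₀ (le_max_right _ _) (by positivity))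

lemma localGain_nonneg (hS : ∀ s ∈ S, s ≤ 3) (v : X) : 0 ≤ localGain S nb η T v := by
  refine edgeSum_nonneg fun s hs u _ => mul_nonneg ?_ (scaledFlow_nonneg _ _ _)
  have : (s : ℚ) ≤ 3 := by exact_mod_cast hS s hs
  linarith

lemma localGain_le_two (hS : ∀ s ∈ S, 1 ≤ s) (v : X) : localGain S nb η T v ≤ 2 := by
  have h : localGain S nb η T v ≤ edgeSum S nb v (fun u s => 2 * scaledFlow S nb η T v u s) := by
    refine edgeSum_le fun s hs u _ => mul_le_mul_of_nonneg_right ?_ (scaledFlow_nonneg _ _ _)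
    have : (1 : ℚ) ≤ s := by exact_mod_cast hS s hs
    linarith
  rw [edgeSum_mul_left] at h
  linarith [edgeSum_scaledFlow_le_one (S := S) (nb := nb) (η := η) (T := T) v]

/-- Prices raised to a feasible solution of the dual linear program. -/
def raisedPrice (S : Finset ℕ) (nb : X → ℕ → Finset X) (η : ℚ) (t : ℕ) (v : X) : ℚ :=
  price S nb η t v +
    edgeSum S nb v (fun u s => max 0 (3 - s - price S nb η t v - price S nb η t u)) / 2

lemma raisedPrice_nonneg (t : ℕ) (v : X) : 0 ≤ raisedPrice S nb η t v := by
  have : 0 ≤ edgeSum S nb v (fun u s => max 0 (3 - s - price S nb η t v - price S nb η t u)) :=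
    edgeSum_nonneg fun _ _ _ _ => le_max_left _ _
  have := price_nonneg (S := S) (nb := nb) (η := η) t v
  unfold raisedPrice
  linarith

lemma le_edgeSum {v u : X} {s : ℕ} {F : X → ℕ → ℚ} (hF : ∀ u s, 0 ≤ F u s) (hs : s ∈ S)
    (hu : u ∈ nb v s) : F u s ≤ edgeSum S nb v F :=
  (Finset.single_le_sum (f := fun u => F u s) (fun u _ => hF u s) hu).trans
    (Finset.single_le_sum (f := fun s => ∑ u ∈ nb v s, F u s)
      (fun s _ => Finset.sum_nonneg fun u _ => hF u s) hs)

/-- Each end of an edge receives at least half of its deficit, so together they close it. -/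
lemma raisedPrice_feasible (hsymm : ∀ s ∈ S, ∀ u v, u ∈ nb v s ↔ v ∈ nb u s) (t : ℕ)
    {v u : X} {s : ℕ} (hs : s ∈ S) (hu : u ∈ nb v s) :
    (3 : ℚ) - s ≤ raisedPrice S nb η t v + raisedPrice S nb η t u := by
  set y := price S nb η t with hy
  have h1 := le_edgeSum (F := fun u s => max 0 (3 - (s : ℚ) - y v - y u))
    (fun _ _ => le_max_left _ _) hs hu
  have h2 := le_edgeSum (F := fun v s => max 0 (3 - (s : ℚ) - y u - y v))
    (fun _ _ => le_max_left _ _) hs ((hsymm s hs u v).1 hu)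
  have h3 := le_max_right 0 (3 - (s : ℚ) - y v - y u)
  have h4 := le_max_right 0 (3 - (s : ℚ) - y u - y v)
  simp only [raisedPrice, ← hy]
  linarith

lemma sum_avgFlow_gain (hT : T ≠ 0) (v : X) :
    ∑ t ∈ Finset.range T, edgeSum S nb v (fun u s => (3 - s) * violated (price S nb η t) v u s) =
      T * edgeSum S nb v (fun u s => (3 - s) * avgFlow S nb η T v u s) := by
  rw [← edgeSum_sum, ← edgeSum_mul_left]
  refine edgeSum_congr fun s _ u _ => ?_
  have : (T : ℚ) ≠ 0 := by exact_mod_cast hT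
  rw [avgFlow, ← Finset.mul_sum]
  field_simp

lemma sum_load (hT : T ≠ 0) (v : X) :
    ∑ t ∈ Finset.range T, edgeSum S nb v (violated (price S nb η t) v) =
      T * avgLoad S nb η T v := by
  rw [avgLoad, ← edgeSum_sum, ← edgeSum_mul_left]
  refine edgeSum_congr fun s _ u _ => ?_
  have : (T : ℚ) ≠ 0 := by exact_mod_cast hT
  rw [avgFlow]
  field_simp

variable [Fintype X]

lemma sum_edgeSum_comm (hsymm : ∀ s ∈ S, ∀ u v, u ∈ nb v s ↔ v ∈ nb u s) (F : X → X → ℕ → ℚ) :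
    ∑ v, edgeSum S nb v (fun u s => F v u s) = ∑ v, edgeSum S nb v (fun u s => F u v s) := by
  simp only [edgeSum]
  rw [Finset.sum_comm]
  conv_rhs => rw [Finset.sum_comm]
  refine Finset.sum_congr rfl fun s hs => ?_
  refine Finset.sum_comm' fun v u => ?_
  simp [hsymm s hs u v]

/-- Projection onto the nonnegative prices does not increase the distance to a nonnegative `p`. The
load lies in `[0, Δ]`, so `1 ≤ Δ` bounds the subgradient `1 - load` by `Δ` in absolute value. -/
lemma price_step {Δ : ℚ} (hΔ : 1 ≤ Δ) (hdeg : ∀ v, edgeSum S nb v (fun _ _ => 1) ≤ Δ)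
    {p : X → ℚ} (hp : ∀ v, 0 ≤ p v) (t : ℕ) :
    ∑ v, (price S nb η (t + 1) v - p v) ^ 2 ≤ ∑ v, (price S nb η t v - p v) ^ 2
      - 2 * η * ∑ v, (1 - edgeSum S nb v (violated (price S nb η t) v)) *
          (price S nb η t v - p v)
      + η ^ 2 * (Fintype.card X * Δ ^ 2) := by
  have hpt : ∀ v, (price S nb η (t + 1) v - p v) ^ 2 ≤ (price S nb η t v - p v) ^ 2
      - 2 * η * ((1 - edgeSum S nb v (violated (price S nb η t) v)) *
          (price S nb η t v - p v)) + η ^ 2 * Δ ^ 2 := by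
    intro v
    set σ := 1 - edgeSum S nb v (violated (price S nb η t) v) with hσ
    have h0 : 0 ≤ edgeSum S nb v (violated (price S nb η t) v) :=
      edgeSum_nonneg fun _ _ _ _ => violated_nonneg _ _ _ _
    have h1 : edgeSum S nb v (violated (price S nb η t) v) ≤ Δ :=
      (edgeSum_le fun _ _ _ _ => violated_le_one _ _ _ _).trans (hdeg v)
    have h2 : σ ^ 2 ≤ Δ ^ 2 := by
      apply sq_le_sq'
      · linarith
      · linarith
    have h3 : (price S nb η (t + 1) v - p v) ^ 2 ≤ (price S nb η t v - η * σ - p v) ^ 2 := by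
      rw [price, ← hσ]
      rcases le_total 0 (price S nb η t v - η * σ) with h | h
      · rw [max_eq_right h]
      · rw [max_eq_left h]
        nlinarith [hp v]
    nlinarith [mul_le_mul_of_nonneg_left h2 (sq_nonneg η)]
  calc _ ≤ _ := Finset.sum_le_sum fun v _ => hpt v
    _ = _ := by
      rw [Finset.sum_add_distrib, Finset.sum_sub_distrib, ← Finset.mul_sum]
      simp
      ring

/-- Telescoping of `price_step`; the start at zero makes the initial squared distance `∑ p²`. -/
lemma price_regret {Δ : ℚ} (hΔ : 1 ≤ Δ) (hdeg : ∀ v, edgeSum S nb v (fun _ _ => 1) ≤ Δ)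
    {p : X → ℚ} (hp : ∀ v, 0 ≤ p v) (T : ℕ) :
    2 * η * ∑ t ∈ Finset.range T, ∑ v, (1 - edgeSum S nb v (violated (price S nb η t) v)) *
          (price S nb η t v - p v) ≤
      ∑ v, p v ^ 2 + T * (η ^ 2 * (Fintype.card X * Δ ^ 2)) := by
  have key : ∀ T : ℕ, 2 * η * ∑ t ∈ Finset.range T,
      ∑ v, (1 - edgeSum S nb v (violated (price S nb η t) v)) * (price S nb η t v - p v) +
        ∑ v, (price S nb η T v - p v) ^ 2 ≤
      ∑ v, p v ^ 2 + T * (η ^ 2 * (Fintype.card X * Δ ^ 2)) := by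
    intro T
    induction T with
    | zero => simp [price]
    | succ T ih =>
      rw [Finset.sum_range_succ]
      have := price_step (η := η) hΔ hdeg hp T
      push_cast
      linarith
  have := key T
  have h0 : 0 ≤ ∑ v, (price S nb η T v - p v) ^ 2 := Finset.sum_nonneg fun _ _ => sq_nonneg _
  linarith

/-- The left side is the penalised dual objective. Its terms linear in the prices collect into
subgradient times price; what remains is the gain of the violated edges, halved because each is
counted at both ends. -/
lemma sum_raisedPrice (hsymm : ∀ s ∈ S, ∀ u v, u ∈ nb v s ↔ v ∈ nb u s) (t : ℕ) :
    ∑ v, raisedPrice S nb η t v =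
      ∑ v, (1 - edgeSum S nb v (violated (price S nb η t) v)) * price S nb η t v +
      (∑ v, edgeSum S nb v (fun u s => (3 - s) * violated (price S nb η t) v u s)) / 2 := by
  set y := price S nb η t
  have h1 : ∑ v, edgeSum S nb v (fun u s => violated y v u s * y v) =
      ∑ v, edgeSum S nb v (fun u s => violated y v u s * y u) := by
    rw [sum_edgeSum_comm hsymm (fun v u s => violated y v u s * y v)]
    simp only [violated_comm y]
  have h2 : ∀ v, edgeSum S nb v (fun u s => max 0 (3 - s - y v - y u)) =
      edgeSum S nb v (fun u s => (3 - s) * violated y v u s)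
        - edgeSum S nb v (fun u s => violated y v u s * y v)
        - edgeSum S nb v (fun u s => violated y v u s * y u) := by
    intro v
    rw [← edgeSum_sub, ← edgeSum_sub]
    refine edgeSum_congr fun s _ u _ => ?_
    rw [violated_mul]; ring
  have h3 : ∀ v, (1 - edgeSum S nb v (violated y v)) * y v =
      y v - edgeSum S nb v (fun u s => violated y v u s * y v) := by
    intro v
    rw [edgeSum_mul_right]; ring
  simp only [raisedPrice]
  rw [Finset.sum_add_distrib, ← Finset.sum_div]
  change ∑ v, y v + (∑ v, edgeSum S nb v (fun u s => max 0 (3 - s - y v - y u))) / 2 = _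
  simp only [h2, h3, Finset.sum_sub_distrib]
  rw [← h1]; ring

/-- Scaling down loses at most twice the total violation. -/
lemma gain_scaledFlow (hsymm : ∀ s ∈ S, ∀ u v, u ∈ nb v s ↔ v ∈ nb u s) (hS : ∀ s ∈ S, 1 ≤ s) :
    (∑ v, edgeSum S nb v (fun u s => (3 - s) * avgFlow S nb η T v u s)) / 2
      - 2 * ∑ v, (max 1 (avgLoad S nb η T v) - 1) ≤ (∑ v, localGain S nb η T v) / 2 := by
  set f := avgFlow S nb η T with hf
  set a : X → ℚ := fun v => max 1 (avgLoad S nb η T v) with ha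
  have ha1 : ∀ v, 1 ≤ a v := fun v => le_max_left _ _
  -- Dividing the flow at `v` by `a v` removes exactly the overload.
  have h1 : ∀ v, edgeSum S nb v (fun u s => f v u s * (1 - (a v)⁻¹)) = a v - 1 := by
    intro v
    rw [edgeSum_mul_right]
    change avgLoad S nb η T v * (1 - (a v)⁻¹) = a v - 1
    rcases le_total 1 (avgLoad S nb η T v) with h | h
    · have : a v = avgLoad S nb η T v := max_eq_right h
      rw [this]
      have : avgLoad S nb η T v ≠ 0 := by linarith
      field_simp
    · have : a v = 1 := max_eq_left h
      rw [this]; simp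
  have h2 : ∑ v, edgeSum S nb v (fun u s => f v u s * (1 - (a u)⁻¹)) = ∑ v, (a v - 1) := by
    rw [← Finset.sum_congr rfl fun v _ => h1 v,
      sum_edgeSum_comm hsymm (fun v u s => f v u s * (1 - (a u)⁻¹))]
    simp only [hf, avgFlow_comm]
  have h3 : ∀ v, edgeSum S nb v (fun u s => (3 - s) * f v u s) ≤ localGain S nb η T v +
      2 * (edgeSum S nb v (fun u s => f v u s * (1 - (a v)⁻¹)) +
        edgeSum S nb v (fun u s => f v u s * (1 - (a u)⁻¹))) := by
    intro v
    rw [localGain, ← edgeSum_add, ← edgeSum_mul_left, ← edgeSum_add]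
    refine edgeSum_le fun s hs u _ => ?_
    have hs1 : (1 : ℚ) ≤ s := by exact_mod_cast hS s hs
    have hf0 : 0 ≤ f v u s := avgFlow_nonneg _ _ _
    have e : scaledFlow S nb η T v u s = f v u s * ((a v)⁻¹ * (a u)⁻¹) := by
      rw [scaledFlow, div_eq_mul_inv, mul_inv]
    rw [e]
    have i1 : (a v)⁻¹ ≤ 1 := inv_le_one_of_one_le₀ (ha1 v)
    have i2 : (a u)⁻¹ ≤ 1 := inv_le_one_of_one_le₀ (ha1 u)
    have j1 : 0 ≤ (a v)⁻¹ := inv_nonneg.2 (zero_le_one.trans (ha1 v))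
    have j2 : 0 ≤ (a u)⁻¹ := inv_nonneg.2 (zero_le_one.trans (ha1 u))
    have k0 : 0 ≤ 1 - (a v)⁻¹ * (a u)⁻¹ := by nlinarith
    have k1 : (3 - (s : ℚ)) * (1 - (a v)⁻¹ * (a u)⁻¹) ≤ 2 * (1 - (a v)⁻¹ * (a u)⁻¹) :=
      mul_le_mul_of_nonneg_right (by linarith) k0
    -- The difference of the two sides is a product of two nonnegative factors, so the losses at the
    -- two ends may be added.
    have k2 : (1 - (a v)⁻¹ * (a u)⁻¹) ≤ (1 - (a v)⁻¹) + (1 - (a u)⁻¹) := by nlinarith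
    have := mul_le_mul_of_nonneg_left (k1.trans (mul_le_mul_of_nonneg_left k2 zero_le_two)) hf0
    linarith
  have h4 := Finset.sum_le_sum fun v (_ : v ∈ Finset.univ) => h3 v
  rw [Finset.sum_add_distrib, ← Finset.mul_sum, Finset.sum_add_distrib, h2,
    Finset.sum_congr rfl fun v _ => h1 v] at h4
  linarith

/-- The scaled flow is almost optimal: there is a feasible solution of the dual linear program
with almost the same value. -/
theorem exists_dual_of_localGain (hsymm : ∀ s ∈ S, ∀ u v, u ∈ nb v s ↔ v ∈ nb u s)
    (hS : ∀ s ∈ S, 1 ≤ s) {Δ : ℚ} (hΔ : 1 ≤ Δ)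
    (hdeg : ∀ v, edgeSum S nb v (fun _ _ => 1) ≤ Δ) (hη : 0 < η) (hT : T ≠ 0) :
    ∃ y : X → ℚ, (∀ v, 0 ≤ y v) ∧ (∀ s ∈ S, ∀ v, ∀ u ∈ nb v s, (3 : ℚ) - s ≤ y v + y u) ∧
      ∑ v, y v ≤ (∑ v, localGain S nb η T v) / 2 +
        Fintype.card X * (2 / (η * T) + η * Δ ^ 2 / 2) := by
  have hT' : (0 : ℚ) < T := by exact_mod_cast Nat.pos_of_ne_zero hT
  -- This comparator contributes twice the total overload to the regret, exactly the loss allowed by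
  -- `gain_scaledFlow`.
  set p : X → ℚ := fun v => if 1 < avgLoad S nb η T v then 2 else 0 with hpdef
  have hp : ∀ v, 0 ≤ p v := fun v => by simp only [hpdef]; split_ifs <;> norm_num
  have hpsq : ∑ v, p v ^ 2 ≤ 4 * Fintype.card X := by
    have : ∀ v ∈ Finset.univ, p v ^ 2 ≤ 4 := fun v _ => by
      simp only [hpdef]; split_ifs <;> norm_num
    have := Finset.sum_le_card_nsmul _ _ _ this
    simp only [Finset.card_univ, nsmul_eq_mul] at this
    linarith
  have hreg := price_regret (η := η) hΔ hdeg hp T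
  have hsplit : ∑ t ∈ Finset.range T, ∑ v, (1 - edgeSum S nb v (violated (price S nb η t) v)) *
          (price S nb η t v - p v) =
      ∑ t ∈ Finset.range T, ∑ v, raisedPrice S nb η t v
      - T * ((∑ v, edgeSum S nb v (fun u s => (3 - s) * avgFlow S nb η T v u s)) / 2)
      + T * (2 * ∑ v, (max 1 (avgLoad S nb η T v) - 1)) := by
    have e1 : ∀ v, ∑ t ∈ Finset.range T,
        (1 - edgeSum S nb v (violated (price S nb η t) v)) * p v =
          - (T * (2 * (max 1 (avgLoad S nb η T v) - 1))) := by
      intro v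
      rw [← Finset.sum_mul, Finset.sum_sub_distrib, sum_load hT]
      simp only [hpdef, Finset.sum_const, Finset.card_range, nsmul_eq_mul, mul_one]
      split_ifs with h
      · rw [max_eq_right h.le]; ring
      · rw [max_eq_left (not_lt.1 h)]; ring
    have e2 : ∑ t ∈ Finset.range T, ∑ v, (1 - edgeSum S nb v (violated (price S nb η t) v)) * p v
        = - (T * (2 * ∑ v, (max 1 (avgLoad S nb η T v) - 1))) := by
      rw [Finset.sum_comm, Finset.sum_congr rfl fun v _ => e1 v, Finset.mul_sum, Finset.mul_sum,
        Finset.sum_neg_distrib]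
    have e3 : ∑ t ∈ Finset.range T, ∑ v, raisedPrice S nb η t v =
        ∑ t ∈ Finset.range T, ∑ v, (1 - edgeSum S nb v (violated (price S nb η t) v)) *
          price S nb η t v +
        T * ((∑ v, edgeSum S nb v (fun u s => (3 - s) * avgFlow S nb η T v u s)) / 2) := by
      rw [Finset.sum_congr rfl fun t _ => sum_raisedPrice hsymm t, Finset.sum_add_distrib,
        ← Finset.sum_div, Finset.sum_comm (f := fun t v => edgeSum S nb v
          (fun u s => (3 - (s : ℚ)) * violated (price S nb η t) v u s)),
        Finset.sum_congr rfl fun v _ => sum_avgFlow_gain hT v, ← Finset.mul_sum]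
      ring
    rw [e3]
    simp only [mul_sub, Finset.sum_sub_distrib]
    simp only [mul_sub, Finset.sum_sub_distrib] at e2
    rw [e2]; ring
  have hgain := gain_scaledFlow (η := η) (T := T) hsymm hS
  set C : ℚ := (∑ v, localGain S nb η T v) / 2 +
        Fintype.card X * (2 / (η * T) + η * Δ ^ 2 / 2) with hC
  have hsum : ∑ t ∈ Finset.range T, ∑ v, raisedPrice S nb η t v ≤
      ∑ t ∈ Finset.range T, C := by
    rw [hsplit] at hreg
    have h2 : 2 * η * (∑ t ∈ Finset.range T, ∑ v, raisedPrice S nb η t v) ≤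
        2 * η * (T * C) := by
      have e : 2 * η * (T * C) = 2 * η * (T * ((∑ v, localGain S nb η T v) / 2)) +
          4 * Fintype.card X + T * (η ^ 2 * (Fintype.card X * Δ ^ 2)) := by
        rw [hC]; field_simp; ring
      rw [e]
      have := mul_le_mul_of_nonneg_left hgain (by positivity : 0 ≤ 2 * η * T)
      linarith
    have := le_of_mul_le_mul_left h2 (by positivity)
    simpa using this
  -- Some iterate is no worse than the mean. It serves only as a certificate and is never computed.
  obtain ⟨t, -, ht⟩ := Finset.exists_le_of_sum_le (by simpa using hT) hsum
  exact ⟨raisedPrice S nb η t, raisedPrice_nonneg t,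
    fun s hs v u hu => raisedPrice_feasible hsymm t hs hu, ht⟩

end Analysis

/-! ### Bounds on the earth mover's distance -/

section Transport

variable {A B : Type*} [Fintype A] [Fintype B]

/-- The unassigned row and column masses have the same total `ρ`, so their product coupling
completes the plan. If `ρ = 0`, they all vanish and the quotient is 0 by convention. -/
lemma exists_transportPlan_ge {P : A → ℝ} {Q : B → ℝ} (hPQ : ∑ x, P x = ∑ y, Q y)
    {z : A → B → ℝ} (hz : ∀ x y, 0 ≤ z x y) (hP : ∀ x, ∑ y, z x y ≤ P x)
    (hQ : ∀ y, ∑ x, z x y ≤ Q y) :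
    ∃ z' : A → B → ℝ, IsTransportPlan P Q z' ∧ ∀ x y, z x y ≤ z' x y := by
  set a : A → ℝ := fun x => P x - ∑ y, z x y with ha
  set b : B → ℝ := fun y => Q y - ∑ x, z x y with hb
  have ha0 : ∀ x, 0 ≤ a x := fun x => sub_nonneg.2 (hP x)
  have hb0 : ∀ y, 0 ≤ b y := fun y => sub_nonneg.2 (hQ y)
  have hab : ∑ x, a x = ∑ y, b y := by
    simp only [ha, hb, Finset.sum_sub_distrib, hPQ]
    rw [Finset.sum_comm]
  set ρ := ∑ x, a x with hρ
  have hρ0 : 0 ≤ ρ := Finset.sum_nonneg fun x _ => ha0 x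
  refine ⟨fun x y => z x y + a x * b y / ρ, ⟨fun x => ?_, fun y => ?_, fun x y => ?_⟩,
    fun x y => ?_⟩
  · rw [Finset.sum_add_distrib, ← Finset.sum_div, ← Finset.mul_sum, ← hab]
    rcases eq_or_ne ρ 0 with h | h
    · have : a x = 0 := (Finset.sum_eq_zero_iff_of_nonneg fun x _ => ha0 x).1 h x
        (Finset.mem_univ x)
      simp only [this, zero_mul, zero_div, add_zero]
      simp only [ha] at this
      linarith
    · rw [mul_div_cancel_right₀ _ h]; simp [ha]
  · rw [Finset.sum_add_distrib, ← Finset.sum_div, ← Finset.sum_mul, ← hρ]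
    rcases eq_or_ne ρ 0 with h | h
    · have : b y = 0 := (Finset.sum_eq_zero_iff_of_nonneg fun y _ => hb0 y).1 (hab ▸ h) y
        (Finset.mem_univ y)
      simp only [this, mul_zero, zero_div, add_zero]
      simp only [hb] at this
      linarith
    · rw [mul_div_cancel_left₀ _ h]; simp [hb]
  · exact add_nonneg (hz x y) (div_nonneg (mul_nonneg (ha0 x) (hb0 y)) hρ0)
  · exact le_add_of_nonneg_right (div_nonneg (mul_nonneg (ha0 x) (hb0 y)) hρ0)

lemma emd_le_of_partial {w : A → B → ℝ} {P : A → ℝ} {Q : B → ℝ} (hPQ : ∑ x, P x = ∑ y, Q y)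
    (hw : ∀ x y, 0 ≤ w x y) {K : ℝ} (hK : ∀ x y, w x y ≤ K)
    {z : A → B → ℝ} (hz : ∀ x y, 0 ≤ z x y) (hP : ∀ x, ∑ y, z x y ≤ P x)
    (hQ : ∀ y, ∑ x, z x y ≤ Q y) :
    emd w P Q ≤ ∑ x, ∑ y, w x y * z x y + K * (∑ x, P x - ∑ x, ∑ y, z x y) := by
  obtain ⟨z', hz', hle⟩ := exists_transportPlan_ge hPQ hz hP hQ
  have h1 : emd w P Q ≤ ∑ x, ∑ y, w x y * z' x y := by
    refine csInf_le ⟨0, ?_⟩ ⟨z', hz', rfl⟩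
    rintro c ⟨z, hz, rfl⟩
    exact Finset.sum_nonneg fun x _ => Finset.sum_nonneg fun y _ => mul_nonneg (hw x y) (hz.2.2 x y)
  have h2 : ∑ x, ∑ y, w x y * (z' x y - z x y) ≤ ∑ x, ∑ y, K * (z' x y - z x y) :=
    Finset.sum_le_sum fun x _ => Finset.sum_le_sum fun y _ =>
      mul_le_mul_of_nonneg_right (hK x y) (sub_nonneg.2 (hle x y))
  simp only [mul_sub, Finset.sum_sub_distrib, ← Finset.mul_sum, hz'.1] at h2
  linarith

/-- Weak Kantorovich duality. A feasible plan must be exhibited, since the infimum of the empty set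
of reals is 0. -/
lemma le_emd_of_potential {w : A → B → ℝ} {P : A → ℝ} {Q : B → ℝ}
    (hPQ : ∑ x, P x = ∑ y, Q y) (hP : ∀ x, 0 ≤ P x) (hQ : ∀ y, 0 ≤ Q y) {φ : A → ℝ} {ψ : B → ℝ}
    (h : ∀ x y, ψ y - φ x ≤ w x y) :
    ∑ y, ψ y * Q y - ∑ x, φ x * P x ≤ emd w P Q := by
  obtain ⟨z₀, hz₀, -⟩ := exists_transportPlan_ge hPQ (z := fun _ _ => 0) (fun _ _ => le_rfl)
    (by simpa using hP) (by simpa using hQ)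
  refine le_csInf ⟨_, z₀, hz₀, rfl⟩ ?_
  rintro c ⟨z, hz, rfl⟩
  have h1 : ∑ x, ∑ y, (ψ y - φ x) * z x y ≤ ∑ x, ∑ y, w x y * z x y :=
    Finset.sum_le_sum fun x _ => Finset.sum_le_sum fun y _ =>
      mul_le_mul_of_nonneg_right (h x y) (hz.2.2 x y)
  have h2 : ∑ x, ∑ y, ψ y * z x y = ∑ y, ψ y * Q y := by
    rw [Finset.sum_comm]
    exact Finset.sum_congr rfl fun y _ => by rw [← Finset.mul_sum, hz.2.1 y]
  have h3 : ∑ x, ∑ y, φ x * z x y = ∑ x, φ x * P x :=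
    Finset.sum_congr rfl fun x _ => by rw [← Finset.mul_sum, hz.1 x]
  simp only [sub_mul, Finset.sum_sub_distrib, h2, h3] at h1
  exact h1

end Transport

/-- Used to extend functions on the sides of `H` by zero to the closed neighbourhoods. -/
lemma sum_dite_mem {V : Type*} [DecidableEq V] {s t : Finset V} (hst : s ⊆ t)
    (f : {x // x ∈ s} → ℝ) :
    ∑ y : {x // x ∈ t}, (if h : y.1 ∈ s then f ⟨y.1, h⟩ else 0) = ∑ r, f r := by
  set g : V → ℝ := fun y => if h : y ∈ s then f ⟨y, h⟩ else 0 with hg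
  have h1 : ∑ y : {x // x ∈ t}, g y.1 = ∑ y ∈ t, g y := Finset.sum_coe_sort t g
  have h2 : ∑ r : {x // x ∈ s}, g r.1 = ∑ y ∈ s, g y := Finset.sum_coe_sort s g
  have h3 : ∑ r : {x // x ∈ s}, g r.1 = ∑ r, f r :=
    Finset.sum_congr rfl fun r _ => by simp [hg]
  change ∑ y : {x // x ∈ t}, g y.1 = _
  rw [h1, ← h3, h2]
  exact (Finset.sum_subset hst fun y _ hy => by simp [hg, hy]).symm

/-! ### Curvature bounds from `H` -/

section Graph

variable {V : Type*} [Fintype V] [DecidableEq V] {G : SimpleGraph V} [DecidableRel G.Adj] {u v : V}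

lemma closedNbr_reachable {x y : V} (hx : x ∈ insert y (G.neighborFinset y)) : G.Reachable x y := by
  rw [Finset.mem_insert, SimpleGraph.mem_neighborFinset] at hx
  rcases hx with rfl | h
  · rfl
  · exact h.symm.reachable

lemma reachable_of_mem_closedNbr (huv : G.Adj u v) {x y : V}
    (hx : x ∈ insert u (G.neighborFinset u)) (hy : y ∈ insert v (G.neighborFinset v)) :
    G.Reachable x y :=
  ((closedNbr_reachable hx).trans huv.reachable).trans (closedNbr_reachable hy).symm

lemma dist_le_one_of_mem_closedNbr {x y : V} (hx : x ∈ insert y (G.neighborFinset y)) :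
    G.dist x y ≤ 1 := by
  rw [Finset.mem_insert, SimpleGraph.mem_neighborFinset] at hx
  rcases hx with rfl | h
  · simp
  · exact (SimpleGraph.dist_eq_one_iff_adj.2 h.symm).le

lemma dist_le_three (huv : G.Adj u v) {x y : V}
    (hx : x ∈ insert u (G.neighborFinset u)) (hy : y ∈ insert v (G.neighborFinset v)) :
    G.dist x y ≤ 3 := by
  have h1 := dist_le_one_of_mem_closedNbr hx
  have h2 := dist_le_one_of_mem_closedNbr hy
  have h3 : G.dist u v = 1 := SimpleGraph.dist_eq_one_iff_adj.2 huv
  have h4 := (closedNbr_reachable hx).dist_triangle_left y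
  have h5 := huv.reachable.dist_triangle_left y
  rw [G.dist_comm (u := y)] at h2
  omega

lemma HLeft_finset (huv : G.Adj u v) :
    G.neighborFinset u \ (G.neighborFinset v ∪ {v}) =
      insert u (G.neighborFinset u) \ insert v (G.neighborFinset v) := by
  ext x
  simp only [Finset.mem_sdiff, Finset.mem_union, Finset.mem_insert, Finset.mem_singleton,
    SimpleGraph.mem_neighborFinset]
  constructor
  · tauto
  · rintro ⟨rfl | h, h2⟩
    · exact absurd (Or.inr huv.symm) h2
    · tauto

lemma HLeft_subset : G.neighborFinset u \ (G.neighborFinset v ∪ {v}) ⊆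
    insert u (G.neighborFinset u) :=
  Finset.sdiff_subset.trans (Finset.subset_insert _ _)

lemma card_closedNbr (x : V) : Fintype.card (ClosedNbr G x) = G.degree x + 1 := by
  rw [Fintype.card_coe, Finset.card_insert_of_notMem (by simp),
    SimpleGraph.card_neighborFinset_eq_degree]

lemma HLeft_notMem (huv : G.Adj u v) (x : HLeft G u v) : x.1 ∉ insert v (G.neighborFinset v) := by
  have := (HLeft_finset huv).le x.2
  exact (Finset.mem_sdiff.1 this).2

lemma card_HLeft (huv : G.Adj u v) :
    (Fintype.card (HLeft G u v) : ℚ) =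
      G.degree u - (G.neighborFinset u ∩ G.neighborFinset v).card - 1 := by
  have h : insert v (G.neighborFinset u ∩ G.neighborFinset v) =
      G.neighborFinset u ∩ (G.neighborFinset v ∪ {v}) := by
    ext x
    simp only [Finset.mem_inter, Finset.mem_union, Finset.mem_insert, Finset.mem_singleton,
      SimpleGraph.mem_neighborFinset]
    constructor
    · rintro (rfl | h)
      · exact ⟨huv, Or.inr rfl⟩
      · tauto
    · tauto
  have h1 := Finset.card_sdiff_add_card_inter (G.neighborFinset u) (G.neighborFinset v ∪ {v})
  rw [← h, Finset.card_insert_of_notMem (by simp), SimpleGraph.card_neighborFinset_eq_degree] at h1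
  rw [Fintype.card_coe, ← h1]
  push_cast; ring

lemma card_HRight (huv : G.Adj u v) :
    (Fintype.card (HRight G u v) : ℚ) =
      G.degree v - (G.neighborFinset u ∩ G.neighborFinset v).card - 1 := by
  rw [Finset.inter_comm]
  exact card_HLeft huv.symm

lemma sum_uniform (x : V) : ∑ _y : ClosedNbr G x, 1 / (1 + (G.degree x : ℝ)) = 1 := by
  rw [Finset.sum_const, Finset.card_univ, card_closedNbr, nsmul_eq_mul]
  push_cast
  have : (0 : ℝ) < 1 + G.degree x := by positivity
  field_simp
  ring

/-- A fractional matching of `H` yields a transport plan. -/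
lemma one_sub_curvature_le (huv : G.Adj u v) (hdeg : G.degree u ≤ G.degree v)
    {X : HLeft G u v → HRight G u v → ℝ} (hX : ∀ l r, 0 ≤ X l r) (hL : ∀ l, ∑ r, X l r ≤ 1)
    (hR : ∀ r, ∑ l, X l r ≤ 1) :
    1 - curvature G u v ≤ (3 * Fintype.card (HRight G u v) -
      ∑ l, ∑ r, (3 - (hWeight G u v l r : ℝ)) * X l r) / (1 + G.degree v) := by
  set n : ℝ := 1 + G.degree v with hn
  have hn0 : 0 < n := by positivity
  have hnm : 1 / n ≤ 1 / (1 + (G.degree u : ℝ)) := by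
    apply one_div_le_one_div_of_le (by positivity)
    have : (G.degree u : ℝ) ≤ G.degree v := by exact_mod_cast hdeg
    linarith
  -- `E` leaves common nodes in place and `Z` is the matching extended by zero. Both are used in
  -- units of `1 / n`, which fits the left masses because `deg u ≤ deg v`.
  set E : ClosedNbr G u → ClosedNbr G v → ℝ := fun x y => if x.1 = y.1 then 1 else 0 with hE
  set Z : ClosedNbr G u → ClosedNbr G v → ℝ := fun x y =>
    if hx : x.1 ∈ G.neighborFinset u \ (G.neighborFinset v ∪ {v}) then
      if hy : y.1 ∈ G.neighborFinset v \ (G.neighborFinset u ∪ {u}) then X ⟨x.1, hx⟩ ⟨y.1, hy⟩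
      else 0 else 0 with hZ
  have hE0 : ∀ x y, 0 ≤ E x y := fun x y => by simp only [hE]; split_ifs <;> norm_num
  have hZ0 : ∀ x y, 0 ≤ Z x y := fun x y => by
    simp only [hZ]; split_ifs <;> first | exact hX _ _ | exact le_rfl
  have hErow : ∀ x, ∑ y, E x y = if x.1 ∈ insert v (G.neighborFinset v) then 1 else 0 := by
    intro x
    have := Finset.sum_coe_sort (insert v (G.neighborFinset v)) fun y =>
      if x.1 = y then (1 : ℝ) else 0
    simp only [hE]
    rw [this, Finset.sum_ite_eq]
  have hEcol : ∀ y, ∑ x, E x y = if y.1 ∈ insert u (G.neighborFinset u) then 1 else 0 := by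
    intro y
    have := Finset.sum_coe_sort (insert u (G.neighborFinset u)) fun x =>
      if x = y.1 then (1 : ℝ) else 0
    simp only [hE]
    rw [this, Finset.sum_ite_eq']
  have hZrow : ∀ x, ∑ y, Z x y =
      if hx : x.1 ∈ G.neighborFinset u \ (G.neighborFinset v ∪ {v}) then ∑ r, X ⟨x.1, hx⟩ r
      else 0 := by
    intro x
    simp only [hZ]
    split_ifs with hx
    · exact sum_dite_mem HLeft_subset (fun r => X ⟨x.1, hx⟩ r)
    · simp
  have hZcol : ∀ y, ∑ x, Z x y =
      if hy : y.1 ∈ G.neighborFinset v \ (G.neighborFinset u ∪ {u}) then ∑ l, X l ⟨y.1, hy⟩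
      else 0 := by
    intro y
    simp only [hZ]
    split_ifs with hy
    · exact sum_dite_mem HLeft_subset (fun l => X l ⟨y.1, hy⟩)
    · simp
  have hrow : ∀ x, ∑ y, (E x y + Z x y) ≤ 1 := by
    intro x
    rw [Finset.sum_add_distrib, hErow, hZrow]
    split_ifs with h1 h2 h2
    · exact absurd h1 (HLeft_notMem huv ⟨x.1, h2⟩)
    · norm_num
    · simpa using hL ⟨x.1, h2⟩
    · norm_num
  have hcol : ∀ y, ∑ x, (E x y + Z x y) ≤ 1 := by
    intro y
    rw [Finset.sum_add_distrib, hEcol, hZcol]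
    split_ifs with h1 h2 h2
    · exact absurd h1 (HLeft_notMem huv.symm ⟨y.1, h2⟩)
    · norm_num
    · simpa using hR ⟨y.1, h2⟩
    · norm_num
  have hEtot : ∑ x, ∑ y, E x y = n - Fintype.card (HRight G u v) := by
    rw [Finset.sum_comm]
    have h1 : ∀ y : ClosedNbr G v, ∑ x, E x y = 1 -
        if h : y.1 ∈ G.neighborFinset v \ (G.neighborFinset u ∪ {u}) then 1 else 0 := by
      intro y
      rw [hEcol]
      have hy := y.2
      by_cases h : y.1 ∈ insert u (G.neighborFinset u)
      · have : y.1 ∉ G.neighborFinset v \ (G.neighborFinset u ∪ {u}) := fun h' =>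
          HLeft_notMem huv.symm ⟨y.1, h'⟩ h
        rw [if_pos h, dif_neg this, sub_zero]
      · have : y.1 ∈ G.neighborFinset v \ (G.neighborFinset u ∪ {u}) := by
          rw [HLeft_finset huv.symm]; exact Finset.mem_sdiff.2 ⟨hy, h⟩
        rw [if_neg h, dif_pos this, sub_self]
    rw [Finset.sum_congr rfl fun y _ => h1 y, Finset.sum_sub_distrib,
      sum_dite_mem HLeft_subset (fun _ : HRight G u v => (1 : ℝ))]
    simp only [Finset.sum_const, Finset.card_univ, card_closedNbr, nsmul_eq_mul, hn]
    push_cast; ring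
  have hZtot : ∀ f : V → V → ℝ, ∑ x : ClosedNbr G u, ∑ y : ClosedNbr G v, f x.1 y.1 * Z x y =
      ∑ l : HLeft G u v, ∑ r : HRight G u v, f l.1 r.1 * X l r := by
    intro f
    rw [← sum_dite_mem HLeft_subset (fun l : HLeft G u v => ∑ r : HRight G u v, f l.1 r.1 * X l r)]
    refine Finset.sum_congr rfl fun x _ => ?_
    by_cases hx : x.1 ∈ G.neighborFinset u \ (G.neighborFinset v ∪ {v})
    · rw [dif_pos hx, ← sum_dite_mem HLeft_subset
        (fun r : HRight G u v => f x.1 r.1 * X ⟨x.1, hx⟩ r)]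
      refine Finset.sum_congr rfl fun y _ => ?_
      simp only [hZ, dif_pos hx]
      split_ifs <;> simp
    · simp only [hZ, dif_neg hx, mul_zero, Finset.sum_const_zero]
  have hmain := emd_le_of_partial (A := ClosedNbr G u) (B := ClosedNbr G v)
    (w := fun x y => (guvWeight G u v x y : ℝ))
    (P := fun _ => 1 / (1 + (G.degree u : ℝ))) (Q := fun _ => 1 / n)
    ((sum_uniform u).trans (sum_uniform v).symm) (fun _ _ => Nat.cast_nonneg _)
    (K := 3) (fun x y => by exact_mod_cast dist_le_three huv x.2 y.2)
    (z := fun x y => (E x y + Z x y) / n)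
    (fun x y => div_nonneg (add_nonneg (hE0 x y) (hZ0 x y)) hn0.le)
    (fun x => by
      rw [← Finset.sum_div]
      exact (div_le_div_of_nonneg_right (hrow x) hn0.le).trans hnm)
    (fun y => by
      rw [← Finset.sum_div]
      exact div_le_div_of_nonneg_right (hcol y) hn0.le)
  have hcost : ∑ x : ClosedNbr G u, ∑ y : ClosedNbr G v,
      (guvWeight G u v x y : ℝ) * ((E x y + Z x y) / n) =
      (∑ l : HLeft G u v, ∑ r : HRight G u v, (hWeight G u v l r : ℝ) * X l r) / n := by
    have h1 := hZtot fun x y => (G.dist x y : ℝ)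
    simp only [hWeight]
    rw [← h1]
    simp only [Finset.sum_div]
    refine Finset.sum_congr rfl fun x _ => Finset.sum_congr rfl fun y _ => ?_
    have : (guvWeight G u v x y : ℝ) * E x y = 0 := by
      simp only [hE, guvWeight]
      split_ifs with h
      · simp [h]
      · simp
    rw [mul_div_assoc', mul_add, this, zero_add]
    rfl
  have hmass : ∑ x : ClosedNbr G u, ∑ y : ClosedNbr G v, (E x y + Z x y) / n =
      (n - Fintype.card (HRight G u v) + ∑ l, ∑ r, X l r) / n := by
    have h1 := hZtot fun _ _ => 1
    simp only [one_mul] at h1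
    simp only [← Finset.sum_div, Finset.sum_add_distrib, hEtot, h1]
  have hgain : ∑ l : HLeft G u v, ∑ r : HRight G u v, (3 - (hWeight G u v l r : ℝ)) * X l r =
      3 * ∑ l, ∑ r, X l r -
        ∑ l : HLeft G u v, ∑ r : HRight G u v, (hWeight G u v l r : ℝ) * X l r := by
    simp only [sub_mul, Finset.sum_sub_distrib, Finset.mul_sum]
  rw [hcost, hmass, sum_uniform] at hmain
  rw [curvature, hgain, sub_sub_cancel]
  refine hmain.trans (le_of_eq ?_)
  field_simp
  ring

/-- A dual solution on `H` yields a Kantorovich potential. -/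
lemma le_one_sub_curvature (huv : G.Adj u v) (hdeg : G.degree u ≤ G.degree v) {K : ℝ}
    {yl : HLeft G u v → ℝ} {yr : HRight G u v → ℝ} (hyr : ∀ r, 0 ≤ yr r)
    (h : ∀ l r, K - yl l - yr r ≤ hWeight G u v l r) :
    (K * Fintype.card (HRight G u v) - ∑ l, yl l - ∑ r, yr r) / (1 + G.degree v) -
      K * ((G.degree v - G.degree u) / (1 + G.degree v)) ≤ 1 - curvature G u v := by
  set n : ℝ := 1 + G.degree v with hn
  set m : ℝ := 1 + G.degree u with hm
  have hn0 : 0 < n := by positivity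
  have hm0 : 0 < m := by positivity
  have hmn : m ≤ n := by
    have : (G.degree u : ℝ) ≤ G.degree v := by exact_mod_cast hdeg
    linarith
  -- The infimum `φ` is a McShane extension of `yl` truncated at `K`. The dual constraints keep it
  -- above `K - yr` on the right side; the truncation bounds its sum over `N[u]`.
  set F : V → Option (HLeft G u v) → ℝ := fun x o => o.elim K fun l => G.dist l.1 x + yl l with hF
  set φ : V → ℝ := fun x => ⨅ o, F x o with hφ
  have hbdd : ∀ x, BddBelow (Set.range (F x)) := fun x => (Set.finite_range _).bddBelow
  have hφK : ∀ x, φ x ≤ K := fun x => ciInf_le (hbdd x) none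
  have hφl : ∀ l : HLeft G u v, φ l.1 ≤ yl l := fun l =>
    (ciInf_le (hbdd l.1) (some l)).trans (by simp [hF])
  have hφr : ∀ r : HRight G u v, K - yr r ≤ φ r.1 := by
    intro r
    refine le_ciInf fun o => ?_
    cases o with
    | none => simpa [hF] using hyr r
    | some l =>
      have := h l r
      simp only [hF, Option.elim, hWeight] at this ⊢
      linarith
  have hlip : ∀ (x : ClosedNbr G u) (y : ClosedNbr G v),
      φ y.1 - φ x.1 ≤ (guvWeight G u v x y : ℝ) := by
    intro x y
    have : φ y.1 - (guvWeight G u v x y : ℝ) ≤ φ x.1 := by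
      refine le_ciInf fun o => ?_
      cases o with
      | none =>
        have := hφK y.1
        have h0 : (0 : ℝ) ≤ guvWeight G u v x y := Nat.cast_nonneg _
        simp only [hF, Option.elim]
        linarith
      | some l =>
        have h1 : φ y.1 ≤ F y.1 (some l) := ciInf_le (hbdd y.1) (some l)
        have h2 := (reachable_of_mem_closedNbr huv x.2 y.2).dist_triangle_right l.1
        have h3 : (G.dist l.1 y.1 : ℝ) ≤ G.dist l.1 x.1 + G.dist x.1 y.1 := by exact_mod_cast h2
        simp only [hF, Option.elim, guvWeight] at h1 ⊢
        linarith
    linarith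
  have hmain := le_emd_of_potential (A := ClosedNbr G u) (B := ClosedNbr G v)
    (w := fun x y => (guvWeight G u v x y : ℝ)) (P := fun _ => 1 / m) (Q := fun _ => 1 / n)
    ((sum_uniform u).trans (sum_uniform v).symm) (fun _ => by positivity) (fun _ => by positivity)
    hlip
  rw [← Finset.sum_mul, ← Finset.sum_mul] at hmain
  have hdiff : ∑ y : ClosedNbr G v, φ y.1 - ∑ x : ClosedNbr G u, φ x.1 =
      ∑ r : HRight G u v, φ r.1 - ∑ l : HLeft G u v, φ l.1 := by
    have e1 := Finset.sum_coe_sort (insert v (G.neighborFinset v)) φ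
    have e2 := Finset.sum_coe_sort (insert u (G.neighborFinset u)) φ
    have e3 := Finset.sum_coe_sort (G.neighborFinset v \ (G.neighborFinset u ∪ {u})) φ
    have e4 := Finset.sum_coe_sort (G.neighborFinset u \ (G.neighborFinset v ∪ {v})) φ
    rw [e1, e2, e3, e4, HLeft_finset huv, HLeft_finset huv.symm, Finset.sum_sdiff_sub_sum_sdiff]
  have hsR : K * Fintype.card (HRight G u v) - ∑ r, yr r ≤ ∑ r : HRight G u v, φ r.1 := by
    have := Finset.sum_le_sum fun r (_ : r ∈ Finset.univ) => hφr r
    simp only [Finset.sum_sub_distrib, Finset.sum_const, Finset.card_univ, nsmul_eq_mul] at this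
    linarith
  have hsL : ∑ l : HLeft G u v, φ l.1 ≤ ∑ l, yl l := Finset.sum_le_sum fun l _ => hφl l
  have hsU : ∑ x : ClosedNbr G u, φ x.1 ≤ m * K := by
    have := Finset.sum_le_sum fun (x : ClosedNbr G u) (_ : x ∈ Finset.univ) => hφK x.1
    rw [Finset.sum_const, Finset.card_univ, card_closedNbr, nsmul_eq_mul] at this
    push_cast at this
    linarith
  have hc : 0 ≤ 1 / m - 1 / n := sub_nonneg.2 (one_div_le_one_div_of_le hm0 hmn)
  rw [curvature, sub_sub_cancel]
  refine le_trans ?_ hmain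
  -- Common nodes cancel in the difference of the sums. The unequal masses leave a multiple of `1 /
  -- m - 1 / n`, which `φ ≤ K` turns into the degree gap.
  have e : (∑ y : ClosedNbr G v, φ y.1) * (1 / n) - (∑ x : ClosedNbr G u, φ x.1) * (1 / m) =
      (∑ r : HRight G u v, φ r.1 - ∑ l : HLeft G u v, φ l.1) / n -
        (∑ x : ClosedNbr G u, φ x.1) * (1 / m - 1 / n) := by
    rw [← hdiff]; ring
  rw [e]
  have h1 : (∑ x : ClosedNbr G u, φ x.1) * (1 / m - 1 / n) ≤ m * K * (1 / m - 1 / n) :=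
    mul_le_mul_of_nonneg_right hsU hc
  have h2 : m * K * (1 / m - 1 / n) = K * ((G.degree v - G.degree u) / n) := by
    field_simp
    simp only [hn, hm]; ring
  have h3 : (K * Fintype.card (HRight G u v) - ∑ l, yl l - ∑ r, yr r) / n ≤
      (∑ r : HRight G u v, φ r.1 - ∑ l : HLeft G u v, φ l.1) / n :=
    div_le_div_of_nonneg_right (by linarith) hn0.le
  linarith

end Graph

/-! ### Exploring the graph -/

lemma draw_support {X : Type*} (s : Finset X) (o : Option X) :
    o ∈ (draw s).support ↔ (o = none ∧ s = ∅) ∨ ∃ z ∈ s, o = some z := by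
  unfold draw
  split_ifs with h
  · simp only [PMF.support_map, PMF.support_uniformOfFinset, Set.mem_image, Finset.mem_coe,
      h.ne_empty, and_false, false_or]
    exact ⟨fun ⟨z, hz, e⟩ => ⟨z, hz, e.symm⟩, fun ⟨z, hz, e⟩ => ⟨z, hz, e.symm⟩⟩
  · rw [Finset.not_nonempty_iff_eq_empty] at h
    simp [h]

section Index

variable {X : Type*} [DecidableEq X]

/-- The number of a node in a list of nodes. -/
def index (l : List X) (z : X) : ℕ := l.idxOf z

lemma index_lt_length {l : List X} {z : X} (h : z ∈ l) : index l z < l.length :=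
  List.idxOf_lt_length_of_mem h

lemma getElem?_index {l : List X} {z : X} (h : z ∈ l) : l[index l z]? = some z :=
  List.getElem?_idxOf h

lemma index_injOn (l : List X) : Set.InjOn (index l) {z | z ∈ l} := fun y hy z hz h => by
  have := getElem?_index hy
  rw [h, getElem?_index hz] at this
  exact (Option.some.inj this).symm

lemma index_eq_of_prefix {l l' : List X} (h : l <+: l') {z : X}
    (hz : z ∈ l) : index l' z = index l z := by
  obtain ⟨t, rfl⟩ := h
  exact List.idxOf_append_of_mem hz

lemma image_index_of_prefix {l l' : List X} (h : l <+: l')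
    {s : Finset X} (hs : s ⊆ l.toFinset) : s.image (index l') = s.image (index l) :=
  Finset.image_congr fun _ hz => index_eq_of_prefix h (List.mem_toFinset.1 (hs hz))

lemma discover_prefix (σ : State X) (z : X) :
    σ.seen <+: (σ.discover (some z)).seen := by
  simp only [State.discover]
  split_ifs
  · exact List.prefix_rfl
  · exact List.prefix_append _ _

lemma discover_nodup {σ : State X} (h : σ.seen.Nodup) (z : X) :
    (σ.discover (some z)).seen.Nodup := by
  simp only [State.discover]
  split_ifs with hz
  · exact h
  · exact (List.nodup_append_comm.1 (List.nodup_cons.2 ⟨hz, h⟩ : ([z] ++ σ.seen).Nodup))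

lemma mem_discover (σ : State X) (z : X) :
    z ∈ (σ.discover (some z)).seen := by
  simp only [State.discover]
  split_ifs with hz <;> simp [hz]

lemma discover_length (σ : State X) (z : X) :
    (σ.discover (some z)).seen.length ≤ σ.seen.length + 1 := by
  simp only [State.discover]
  split_ifs <;> simp

lemma index_discover (σ : State X) (z : X) :
    index (σ.discover (some z)).seen z = index σ.seen z := by
  simp only [State.discover]
  split_ifs with hz
  · rfl
  -- For an absent element `idxOf` is the length of the list, which is the number the new node
  -- receives.
  · rw [index, index, List.idxOf_append_of_notMem hz, List.idxOf_eq_length hz]; simp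

end Index

section Explore

variable {A B : Type*} [Fintype A] [Fintype B] [DecidableEq A] [DecidableEq B]

/-- Every run of the program outputs `q` after at most `n` instructions. -/
def Outputs (w : A → B → ℕ) (env : Fin 3 → ℚ) (p : Prog) (σ : State (A ⊕ B)) (q : ℚ) (n : ℕ) :
    Prop :=
  ∀ o ∈ (p.run w env σ).support, o.1 = q ∧ o.2 ≤ n

variable {w : A → B → ℕ} {env : Fin 3 → ℚ} {σ : State (A ⊕ B)} {q : ℚ} {n : ℕ}

lemma Outputs.mono {p : Prog} (h : Outputs w env p σ q n) {m : ℕ} (hnm : n ≤ m) :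
    Outputs w env p σ q m :=
  fun o ho => ⟨(h o ho).1, (h o ho).2.trans hnm⟩

lemma outputs_output (e : Expr) (n : ℕ) : Outputs w env (.output e) σ (e.eval env) n := by
  intro o ho
  simp only [Prog.run, PMF.support_pure, Set.mem_singleton_iff] at ho
  simp [ho]

lemma outputs_query {i s : ℕ} {k : Option ℕ → Prog}
    (h0 : answers w σ i s = ∅ → Outputs w env (k none) σ q n)
    (h1 : ∀ z ∈ answers w σ i s, Outputs w env (k (some (index σ.seen z)))
      ((σ.record i s (some z)).discover (some z)) q n) :
    Outputs w env (.query i s k) σ q (n + 1) := by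
  intro o ho
  simp only [Prog.run, PMF.mem_support_bind_iff, PMF.mem_support_map_iff, draw_support] at ho
  obtain ⟨a, (⟨rfl, ha⟩ | ⟨z, hz, rfl⟩), o', ho', rfl⟩ := ho
  · have := h0 ha o' ho'
    exact ⟨this.1, Nat.succ_le_succ this.2⟩
  · have := h1 z hz o' ho'
    exact ⟨this.1, Nat.succ_le_succ this.2⟩

/-- Repeat the query for the weight `s` at node number `i`, at most `f` times. -/
def collect (i s : ℕ) : ℕ → Finset ℕ → (Finset ℕ → Prog) → Prog
  | 0, acc, k => k acc
  | f + 1, acc, k => .query i s fun o => o.elim (k acc) fun j => collect i s f (insert j acc) k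

lemma collect_onlyWeight {i s : ℕ} {k : Finset ℕ → Prog} (hk : ∀ acc, (k acc).OnlyWeight s)
    (f : ℕ) (acc : Finset ℕ) : (collect i s f acc k).OnlyWeight s := by
  induction f generalizing acc with
  | zero => exact hk acc
  | succ f ih =>
    refine ⟨rfl, fun o => ?_⟩
    cases o with
    | none => exact hk acc
    | some j => exact ih _

/-- No node carries the number `i`, so the first query returns the special symbol. -/
lemma outputs_collect_of_getElem?_eq_none {i s : ℕ} (hi : σ.seen[i]? = none)
    {k : Finset ℕ → Prog} {acc : Finset ℕ} (hk : Outputs w env (k acc) σ q n) (f : ℕ) :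
    Outputs w env (collect i s f acc k) σ q (n + f) := by
  have ha : answers w σ i s = ∅ := by simp [answers, hi]
  cases f with
  | zero => exact hk
  | succ f =>
    refine (outputs_query (fun _ => hk) fun z hz => ?_).mono (show n + 1 ≤ n + (f + 1) by omega)
    simp [ha] at hz

/-- With enough repetitions, all neighbours for the weight `s` are found. -/
lemma outputs_collect {i s : ℕ} {x : A ⊕ B} {k : Finset ℕ → Prog} (f : ℕ)
    (σ : State (A ⊕ B)) (hx : σ.seen[i]? = some x) (hnd : σ.seen.Nodup)
    (hA : σ.answered x s ⊆ σ.seen.toFinset) (hN : σ.answered x s ⊆ wNbrs w x s)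
    (hf : (wNbrs w x s).card ≤ f + (σ.answered x s).card)
    (hk : ∀ σ' : State (A ⊕ B), σ.seen <+: σ'.seen → σ'.seen.Nodup →
      wNbrs w x s ⊆ σ'.seen.toFinset → σ'.seen.length ≤ σ.seen.length + f →
      (∀ y t, ¬(y = x ∧ t = s) → σ'.answered y t = σ.answered y t) →
      Outputs w env (k ((wNbrs w x s).image (index σ'.seen))) σ' q n) :
    Outputs w env (collect i s f ((σ.answered x s).image (index σ.seen)) k) σ q (n + f) := by
  induction f generalizing σ with
  | zero =>
    have h := Finset.eq_of_subset_of_card_le hN (by omega)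
    simp only [collect, h]
    exact hk σ List.prefix_rfl hnd (h ▸ hA) le_rfl fun _ _ _ => rfl
  | succ f ih =>
    have ha : answers w σ i s = wNbrs w x s \ σ.answered x s := by simp [answers, hx]
    refine outputs_query (fun h0 => ?_) (fun z hz => ?_)
    · rw [ha, Finset.sdiff_eq_empty_iff_subset] at h0
      have h : σ.answered x s = wNbrs w x s := hN.antisymm h0
      simp only [Option.elim, h]
      exact (hk σ List.prefix_rfl hnd (h ▸ hA) (by omega) fun _ _ _ => rfl).mono
        (Nat.le_add_right n f)
    · rw [ha, Finset.mem_sdiff] at hz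
      set τ := σ.record i s (some z) with hτ
      have hτs : τ.seen = σ.seen := rfl
      set σ₁ := τ.discover (some z) with hσ₁
      have hpre : σ.seen <+: σ₁.seen := discover_prefix τ z
      have hans : ∀ y t, σ₁.answered y t =
          if y = x ∧ t = s then insert z (σ.answered y t) else σ.answered y t := by
        intro y t
        simp only [hσ₁, hτ, State.discover, State.record, hx, Option.some.injEq, eq_comm (a := x)]
      have hansx : σ₁.answered x s = insert z (σ.answered x s) := by simp [hans]
      have hmem : z ∈ σ₁.seen := mem_discover τ z
      have hA₁ : insert z (σ.answered x s) ⊆ σ₁.seen.toFinset := by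
        refine Finset.insert_subset (List.mem_toFinset.2 hmem) fun y hy => ?_
        exact List.mem_toFinset.2 (hpre.subset (List.mem_toFinset.1 (hA hy)))
      have hacc : insert (index σ.seen z) ((σ.answered x s).image (index σ.seen)) =
          (σ₁.answered x s).image (index σ₁.seen) := by
        rw [hansx, Finset.image_insert, image_index_of_prefix hpre hA]
        congr 1
        exact (index_discover τ z).symm
      simp only [Option.elim]
      rw [hacc]
      have hlen : σ₁.seen.length ≤ σ.seen.length + 1 := discover_length τ z
      refine ih σ₁ ?_ (discover_nodup hnd z) (hansx ▸ hA₁) ?_ ?_ fun σ' h1 h2 h3 h4 h5 => ?_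
      · obtain ⟨t, ht⟩ := hpre
        rw [← ht, List.getElem?_append_left (List.getElem?_eq_some_iff.1 hx).1, hx]
      · rw [hansx]; exact Finset.insert_subset hz.1 hN
      · rw [hansx, Finset.card_insert_of_notMem hz.2]; omega
      · refine hk σ' (hpre.trans h1) h2 h3 (by omega) fun y t hyt => ?_
        rw [h5 y t hyt, hans, if_neg hyt]

/-- Execute a list of tasks: for the task `(i, s)`, find the neighbours of node number `i` for the
weight `s`, and enter them into a table. -/
def explore (f : ℕ) : List (ℕ × ℕ) → (ℕ → ℕ → Finset ℕ) →
    ((ℕ → ℕ → Finset ℕ) → Prog) → Prog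
  | [], tbl, k => k tbl
  | (i, s) :: tasks, tbl, k => collect i s f ∅ fun acc =>
      explore f tasks (fun j t => if j = i ∧ t = s then acc else tbl j t) k

/-- Sorting by node number makes the exploration breadth-first. Once a task meets an unassigned
number, so do all later ones and discovery stops; hence no node receives its number after its task
was skipped. Each task discovers at most `f` nodes, so neighbours found by tasks at numbers below
`b` get small numbers. -/
lemma outputs_explore {f : ℕ} {k : (ℕ → ℕ → Finset ℕ) → Prog} (tasks : List (ℕ × ℕ))
    (hdeg : ∀ i s, (i, s) ∈ tasks → ∀ x, (wNbrs w x s).card ≤ f)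
    (σ : State (A ⊕ B)) (tbl : ℕ → ℕ → Finset ℕ) (hnd : σ.seen.Nodup) (htasks : tasks.Nodup)
    (hsort : tasks.Pairwise fun a b => a.1 ≤ b.1)
    (hnew : ∀ x, x ∉ σ.seen → ∀ s, σ.answered x s = ∅)
    (hfresh : ∀ i s, (i, s) ∈ tasks → ∀ x, σ.seen[i]? = some x → σ.answered x s = ∅)
    (hk : ∀ (σ' : State (A ⊕ B)) (tbl' : ℕ → ℕ → Finset ℕ), σ.seen <+: σ'.seen →
      σ'.seen.Nodup →
      (∀ i s, (i, s) ∉ tasks → tbl' i s = tbl i s) →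
      ((∀ i s, (i, s) ∈ tasks → σ.seen.length ≤ i) → σ'.seen = σ.seen) →
      (∀ i s, (i, s) ∈ tasks → ∀ x, σ'.seen[i]? = some x →
        wNbrs w x s ⊆ σ'.seen.toFinset ∧ tbl' i s = (wNbrs w x s).image (index σ'.seen) ∧
        ∀ b, i < b → ∀ z ∈ wNbrs w x s,
          index σ'.seen z < σ.seen.length + f * tasks.countP (fun a => a.1 < b)) →
      Outputs w env (k tbl') σ' q n) :
    Outputs w env (explore f tasks tbl k) σ q (n + f * tasks.length) := by
  induction tasks generalizing σ tbl with
  | nil =>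
    exact hk σ tbl List.prefix_rfl hnd (fun _ _ _ => rfl) (fun _ => rfl) (by simp)
  | cons a tasks ih =>
    obtain ⟨i, s⟩ := a
    rw [List.nodup_cons] at htasks
    rw [List.pairwise_cons] at hsort
    have hn : n + f * ((i, s) :: tasks).length = (n + f * tasks.length) + f := by
      rw [List.length_cons]; ring
    rw [hn, explore]
    have hdeg' : ∀ i s, (i, s) ∈ tasks → ∀ x, (wNbrs w x s).card ≤ f :=
      fun i s h => hdeg i s (List.mem_cons_of_mem _ h)
    cases hx : σ.seen[i]? with
    | none =>
      refine outputs_collect_of_getElem?_eq_none hx ?_ f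
      have hlen := List.getElem?_eq_none_iff.1 hx
      refine ih hdeg' σ _ hnd htasks.2 hsort.2 hnew
        (fun j t hj => hfresh j t (List.mem_cons_of_mem _ hj))
        fun σ' tbl' h1 h2 h3 h4 h5 => ?_
      have hseen : σ'.seen = σ.seen := h4 fun j t hj => hlen.trans (hsort.1 _ hj)
      refine hk σ' tbl' h1 h2 (fun j t hj => ?_) (fun _ => hseen) fun j t hj x hjx => ?_
      · rw [List.mem_cons, not_or] at hj
        rw [h3 j t hj.2, if_neg]
        rintro ⟨rfl, rfl⟩
        exact hj.1 rfl
      · rcases List.mem_cons.1 hj with e | hj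
        · cases e
          rw [hseen, hx] at hjx
          cases hjx
        · obtain ⟨g1, g2, g3⟩ := h5 j t hj x hjx
          refine ⟨g1, g2, fun b hb z hz => (g3 b hb z hz).trans_le ?_⟩
          gcongr
          rw [List.countP_cons]
          exact Nat.le_add_right _ _
    | some x =>
      have hemp : σ.answered x s = ∅ := hfresh i s List.mem_cons_self x hx
      have hcol := outputs_collect (w := w) (env := env) (q := q) (n := n + f * tasks.length)
        (i := i) (s := s) (k := fun acc =>
          explore f tasks (fun j t => if j = i ∧ t = s then acc else tbl j t) k) f σ hx hnd
        (by simp [hemp]) (by simp [hemp])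
        ((hdeg i s List.mem_cons_self x).trans (Nat.le_add_right _ _))
      simp only [hemp, Finset.image_empty] at hcol
      refine hcol fun σ₁ hpre hnd₁ hsub hlen hans => ?_
      have hx₁ : σ₁.seen[i]? = some x := by
        obtain ⟨t, ht⟩ := hpre
        rw [← ht, List.getElem?_append_left (List.getElem?_eq_some_iff.1 hx).1, hx]
      have hnew₁ : ∀ y, y ∉ σ₁.seen → ∀ s, σ₁.answered y s = ∅ := by
        intro y hy t
        have hyx : y ≠ x := fun e => hy (e ▸ List.mem_of_getElem? hx₁)
        rw [hans y t fun h => hyx h.1]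
        exact hnew y (fun h => hy (hpre.subset h)) t
      refine ih hdeg' σ₁ _ hnd₁ htasks.2 hsort.2 hnew₁ (fun j t hj y hy => ?_)
        fun σ' tbl' h1 h2 h3 h4 h5 => ?_
      · have hne : ¬(y = x ∧ t = s) := by
          rintro ⟨rfl, rfl⟩
          obtain ⟨l1, e1⟩ := List.getElem?_eq_some_iff.1 hy
          obtain ⟨l2, e2⟩ := List.getElem?_eq_some_iff.1 hx₁
          have : j = i := (hnd₁.getElem_inj_iff).1 (e1.trans e2.symm)
          subst this
          exact htasks.1 hj
        rw [hans y t hne]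
        by_cases hys : y ∈ σ.seen
        · refine hfresh j t (List.mem_cons_of_mem _ hj) y ?_
          obtain ⟨l1, e1⟩ := List.getElem?_eq_some_iff.1 hy
          obtain ⟨m, l2, e2⟩ := List.getElem_of_mem hys
          have l2' : m < σ₁.seen.length := l2.trans_le hpre.length_le
          have e2' : σ₁.seen[m] = y := by rw [← hpre.getElem l2]; exact e2
          have : j = m := (hnd₁.getElem_inj_iff).1 (e1.trans e2'.symm)
          subst this
          exact List.getElem?_eq_some_iff.2 ⟨l2, e2⟩
        · exact hnew y hys t
      · refine hk σ' tbl' (hpre.trans h1) h2 (fun j t hj => ?_) (fun h => ?_)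
          fun j t hj y hjy => ?_
        · rw [List.mem_cons, not_or] at hj
          rw [h3 j t hj.2, if_neg]
          rintro ⟨rfl, rfl⟩
          exact hj.1 rfl
        · exact absurd (List.getElem?_eq_some_iff.1 hx).1
            (not_lt.2 (h i s List.mem_cons_self))
        · rcases List.mem_cons.1 hj with e | hj
          · cases e
            have hyx : y = x := by
              obtain ⟨t, ht⟩ := h1
              rw [← ht, List.getElem?_append_left (List.getElem?_eq_some_iff.1 hx₁).1, hx₁] at hjy
              exact (Option.some.inj hjy).symm
            subst hyx
            refine ⟨fun z hz => List.mem_toFinset.2 (h1.subset (List.mem_toFinset.1 (hsub hz))),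
              ?_, fun b hb z hz => ?_⟩
            · rw [h3 i s htasks.1, if_pos ⟨rfl, rfl⟩, image_index_of_prefix h1 hsub]
            · rw [index_eq_of_prefix h1 (List.mem_toFinset.1 (hsub hz)), List.countP_cons,
                if_pos (by simpa using hb)]
              have := index_lt_length (List.mem_toFinset.1 (hsub hz))
              rw [mul_add]
              omega
          · obtain ⟨g1, g2, g3⟩ := h5 j t hj y hjy
            refine ⟨g1, g2, fun b hb z hz => (g3 b hb z hz).trans_le ?_⟩
            have hib : i < b := (hsort.1 _ hj).trans_lt hb
            rw [List.countP_cons, if_pos (by simpa using hib), mul_add]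
            omega

end Explore

/-! ### The local gain is determined by the table -/

section Locality

variable {X : Type*} {S : Finset ℕ} {nb : X → ℕ → Finset X} {η : ℚ} {T : ℕ}
  {tbl : ℕ → ℕ → Finset ℕ} {num : X → ℕ} {P : ℕ → X → Prop}

/-- `P j x` says that the table is correct within distance `j` of `x`. -/
def CorrectTable (S : Finset ℕ) (nb : X → ℕ → Finset X) (tbl : ℕ → ℕ → Finset ℕ) (num : X → ℕ)
    (P : ℕ → X → Prop) : Prop :=
  ∀ j x, P (j + 1) x → P j x ∧ ∀ s ∈ S, tbl (num x) s = (nb x s).image num ∧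
    Set.InjOn num (nb x s) ∧ ∀ u ∈ nb x s, P j u

/-- The algorithm runs the same dynamics on node numbers, with the table as adjacency; injectivity
of `num` on neighbours matches the sums. -/
lemma CorrectTable.edgeSum_eq (h : CorrectTable S nb tbl num P) {j : ℕ} {x : X} (hx : P (j + 1) x)
    {F : ℕ → ℕ → ℚ} {F' : X → ℕ → ℚ} (hF : ∀ u s, P j u → F (num u) s = F' u s) :
    edgeSum S tbl (num x) F = edgeSum S nb x F' := by
  refine Finset.sum_congr rfl fun s hs => ?_
  obtain ⟨h1, h2, h3⟩ := (h j x hx).2 s hs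
  rw [h1, Finset.sum_image h2]
  exact Finset.sum_congr rfl fun u hu => hF u s (h3 u hu)

lemma CorrectTable.anti (h : CorrectTable S nb tbl num P) {i j : ℕ} (hij : i ≤ j) {x : X}
    (hx : P j x) : P i x := by
  induction hij with
  | refl => exact hx
  | step _ ih => exact ih (h _ _ hx).1

lemma CorrectTable.price_eq (h : CorrectTable S nb tbl num P) (t : ℕ) {x : X} (hx : P t x) :
    price S tbl η t (num x) = price S nb η t x := by
  induction t generalizing x with
  | zero => rfl
  | succ t ih =>
    have hxt := ih (h t x hx).1
    rw [price, price, hxt, h.edgeSum_eq hx (F' := violated (price S nb η t) x) fun u s hu => ?_]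
    simp only [violated, hxt, ih hu]

lemma CorrectTable.avgFlow_eq (h : CorrectTable S nb tbl num P) {x u : X} (hx : P T x)
    (hu : P T u) (s : ℕ) : avgFlow S tbl η T (num x) (num u) s = avgFlow S nb η T x u s := by
  unfold avgFlow
  congr 1
  refine Finset.sum_congr rfl fun t ht => ?_
  have ht' := (Finset.mem_range.1 ht).le
  simp only [violated, h.price_eq t (h.anti ht' hx), h.price_eq t (h.anti ht' hu)]

lemma CorrectTable.avgLoad_eq (h : CorrectTable S nb tbl num P) {x : X} (hx : P (T + 1) x) :
    avgLoad S tbl η T (num x) = avgLoad S nb η T x :=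
  h.edgeSum_eq hx fun _ s hu => h.avgFlow_eq (h T x hx).1 hu s

/-- Average flows need radius `T` at both ends, loads one step more, and the loads of the neighbours
another. -/
lemma CorrectTable.localGain_eq (h : CorrectTable S nb tbl num P) {x : X} (hx : P (T + 2) x) :
    localGain S tbl η T (num x) = localGain S nb η T x := by
  refine h.edgeSum_eq hx fun u s hu => ?_
  have hx1 := (h (T + 1) x hx).1
  rw [scaledFlow, scaledFlow, h.avgFlow_eq (h T x hx1).1 (h T u hu).1, h.avgLoad_eq hx1,
    h.avgLoad_eq hu]

end Locality

/-! ### Uniform samples -/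

section Average

variable {A : Type*} [Fintype A]

/-- Average of a function over all lists of length `k`. -/
def avgList : ℕ → (List A → ℝ) → ℝ
  | 0, F => F []
  | k + 1, F => (∑ a, avgList k fun l => F (a :: l)) / Fintype.card A

lemma avgList_mono (k : ℕ) {F F' : List A → ℝ} (h : ∀ l, l.length = k → F l ≤ F' l) :
    avgList k F ≤ avgList k F' := by
  induction k generalizing F F' with
  | zero => exact h [] rfl
  | succ k ih =>
    exact div_le_div_of_nonneg_right (Finset.sum_le_sum fun a _ =>
      ih fun l hl => h _ (by simp [hl]))
      (Nat.cast_nonneg _)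

lemma avgList_one_sub [Nonempty A] (k : ℕ) (c : ℝ) (F : List A → ℝ) :
    avgList k (fun l => 1 - c * F l) = 1 - c * avgList k F := by
  induction k generalizing F with
  | zero => rfl
  | succ k ih =>
    have hN : (Fintype.card A : ℝ) ≠ 0 := by exact_mod_cast Fintype.card_ne_zero
    simp only [avgList, ih, Finset.sum_sub_distrib, ← Finset.mul_sum, Finset.sum_const,
      Finset.card_univ, nsmul_eq_mul, mul_one]
    field_simp

lemma avgList_nonneg (k : ℕ) {F : List A → ℝ} (h : ∀ l, 0 ≤ F l) : 0 ≤ avgList k F := by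
  induction k generalizing F with
  | zero => exact h []
  | succ k ih =>
    exact div_nonneg (Finset.sum_nonneg fun a _ => ih fun l => h _) (Nat.cast_nonneg _)

/-- Variances of independent samples add: the cross term averages to zero because `g` does. The
offset `c` carries the induction. -/
lemma avgList_sq_le [Nonempty A] {g : A → ℝ} (hg : ∑ a, g a = 0) {C : ℝ} (hC : ∀ a, g a ^ 2 ≤ C)
    (k : ℕ) (c : ℝ) : avgList k (fun l => (c + (l.map g).sum) ^ 2) ≤ c ^ 2 + k * C := by
  induction k generalizing c with
  | zero => simp [avgList]
  | succ k ih =>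
    have hN : (0 : ℝ) < Fintype.card A := by exact_mod_cast Fintype.card_pos
    simp only [avgList, List.map_cons, List.sum_cons]
    rw [div_le_iff₀ hN]
    calc ∑ a, avgList k (fun l => (c + (g a + (l.map g).sum)) ^ 2)
        ≤ ∑ a, (c ^ 2 + (k + 1) * C + 2 * c * g a) := by
          refine Finset.sum_le_sum fun a _ => ?_
          have := ih (c + g a)
          simp only [add_assoc] at this
          nlinarith [hC a]
      _ = _ := by
          rw [Finset.sum_add_distrib, ← Finset.mul_sum, hg, Finset.sum_const, Finset.card_univ,
            nsmul_eq_mul]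
          push_cast; ring

open Classical in
/-- Chebyshev's inequality for the mean of uniform samples. -/
lemma two_thirds_le_avgList [Nonempty A] {h : A → ℝ} (h0 : ∀ a, 0 ≤ h a) (h2 : ∀ a, h a ≤ 2)
    {ε : ℝ} (hε : 0 < ε) {k : ℕ} (hk : 12 ≤ k * ε ^ 2) :
    2 / 3 ≤ avgList k fun l =>
      if |(l.map h).sum / k - (∑ a, h a) / Fintype.card A| ≤ ε then (1 : ℝ) else 0 := by
  have hN : (0 : ℝ) < Fintype.card A := by exact_mod_cast Fintype.card_pos
  have hk0 : (0 : ℝ) < k := by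
    by_contra hk0
    have : (k : ℝ) * ε ^ 2 ≤ 0 := mul_nonpos_of_nonpos_of_nonneg (not_lt.1 hk0) (sq_nonneg ε)
    linarith
  set μ : ℝ := (∑ a, h a) / Fintype.card A with hμ
  have hsum : ∑ a, h a ≤ Fintype.card A * 2 := by
    have := Finset.sum_le_sum fun a (_ : a ∈ Finset.univ) => h2 a
    simpa using this
  have hμ0 : 0 ≤ μ := div_nonneg (Finset.sum_nonneg fun a _ => h0 a) hN.le
  have hμ2 : μ ≤ 2 := by rw [hμ, div_le_iff₀ hN]; linarith
  set g : A → ℝ := fun a => h a - μ with hg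
  have hg0 : ∑ a, g a = 0 := by
    simp only [hg, Finset.sum_sub_distrib, Finset.sum_const, Finset.card_univ, nsmul_eq_mul, hμ]
    field_simp
    ring
  have hg4 : ∀ a, g a ^ 2 ≤ 4 := fun a => by
    have := h0 a
    have := h2 a
    simp only [hg]
    nlinarith
  have hvar := avgList_sq_le hg0 hg4 k 0
  simp only [zero_add, ne_eq, OfNat.ofNat_ne_zero, not_false_eq_true, zero_pow] at hvar
  have hkε : 0 < ((k : ℝ) * ε) ^ 2 := by positivity
  -- The second moment is at most `4 k`, so the failure probability is at most `4 / (k ε²) ≤ 1 / 3`.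
  calc (2 : ℝ) / 3 ≤ 1 - (((k : ℝ) * ε) ^ 2)⁻¹ * avgList k (fun l => (l.map g).sum ^ 2) := by
        have : (((k : ℝ) * ε) ^ 2)⁻¹ * avgList k (fun l => (l.map g).sum ^ 2) ≤
            (((k : ℝ) * ε) ^ 2)⁻¹ * (k * 4) :=
          mul_le_mul_of_nonneg_left hvar (inv_nonneg.2 hkε.le)
        have h3 : (((k : ℝ) * ε) ^ 2)⁻¹ * (k * 4) ≤ 1 / 3 := by
          rw [inv_mul_le_iff₀ hkε]
          nlinarith
        linarith
    _ = avgList k (fun l => 1 - (((k : ℝ) * ε) ^ 2)⁻¹ * (l.map g).sum ^ 2) :=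
        (avgList_one_sub k _ _).symm
    _ ≤ _ := by
        refine avgList_mono k fun l hl => ?_
        have hlg : (l.map g).sum = (l.map h).sum - k * μ := by
          rw [← hl]
          clear hl
          induction l with
          | nil => simp
          | cons a l ih => 
            rw [List.map_cons, List.sum_cons, ih, List.map_cons, List.sum_cons, List.length_cons]
            simp only [hg]
            push_cast
            ring
        split_ifs with hgood
        · have : 0 ≤ (((k : ℝ) * ε) ^ 2)⁻¹ * (l.map g).sum ^ 2 := by positivity
          linarith
        · rw [sub_nonpos, le_inv_mul_iff₀ hkε, mul_one]
          have h1 : (l.map g).sum = k * ((l.map h).sum / k - μ) := by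
            rw [hlg]; field_simp
          rw [h1, mul_pow, mul_pow]
          refine mul_le_mul_of_nonneg_left ?_ (sq_nonneg _)
          rw [← sq_abs ((l.map h).sum / k - μ)]
          exact pow_le_pow_left₀ hε.le (not_le.1 hgood).le 2

end Average

/-! ### Sampling as a program -/

section Sample

variable {A B : Type*}

/-- Draw `r` random nodes of the left side; if it is empty, continue with `z`. -/
def sampleMany (z : Prog) : ℕ → List ℕ → (List ℕ → Prog) → Prog
  | 0, acc, k => k acc
  | r + 1, acc, k => .sampleLeft fun o => o.elim z fun i => sampleMany z r (acc ++ [i]) k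

/-- States in which the nodes in the list `l` have been sampled, and nothing else was done. -/
structure Sampled (l : List A) (σ : State (A ⊕ B)) : Prop where
  nodup : σ.seen.Nodup
  answered : ∀ x s, σ.answered x s = ∅
  mem : ∀ a ∈ l, Sum.inl a ∈ σ.seen
  length : σ.seen.length ≤ l.length

lemma Sampled.init : Sampled ([] : List A) (State.init ([] : List (A ⊕ B))) :=
  ⟨List.nodup_nil, fun _ _ => rfl, by simp, le_rfl⟩

variable [DecidableEq A] [DecidableEq B]

/-- The numbers of the sampled nodes. -/
def numbers (l : List A) (σ : State (A ⊕ B)) : List ℕ := l.map fun a => index σ.seen (Sum.inl a)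

lemma Sampled.concat {l : List A} {σ : State (A ⊕ B)} (h : Sampled l σ) (a : A) :
    Sampled (l ++ [a]) (σ.discover (some (Sum.inl a))) where
  nodup := discover_nodup h.nodup _
  answered := h.answered
  mem b hb := by
    rcases List.mem_append.1 hb with hb | hb
    · exact (discover_prefix σ _).subset (h.mem b hb)
    · rw [List.mem_singleton.1 hb]; exact mem_discover σ _
  length := by
    have := discover_length σ (Sum.inl a)
    have := h.length
    simp only [List.length_append, List.length_singleton]
    omega

lemma Sampled.numbers_concat {l : List A} {σ : State (A ⊕ B)} (h : Sampled l σ) (a : A) :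
    numbers (l ++ [a]) (σ.discover (some (Sum.inl a))) =
      numbers l σ ++ [index σ.seen (Sum.inl a)] := by
  simp only [numbers, List.map_append, List.map_singleton, index_discover]
  congr 1
  exact List.map_congr_left fun b hb => index_eq_of_prefix (discover_prefix σ _) (h.mem b hb)

variable [Fintype A] [Fintype B] {w : A → B → ℕ} {env : Fin 3 → ℚ} {z : Prog}
  {k : List ℕ → Prog} {n : ℕ}

lemma outputs_sampleMany_of_isEmpty [IsEmpty A] {σ : State (A ⊕ B)} {q : ℚ}
    (hz : Outputs w env z σ q n) (r : ℕ) (acc : List ℕ) :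
    Outputs w env (sampleMany z (r + 1) acc k) σ q (n + 1) := by
  intro o ho
  simp only [sampleMany, Prog.run, PMF.mem_support_bind_iff, PMF.mem_support_map_iff,
    draw_support] at ho
  obtain ⟨a, (⟨rfl, ha⟩ | ⟨x, hx, rfl⟩), o', ho', rfl⟩ := ho
  · have := hz o' ho'
    exact ⟨this.1, Nat.succ_le_succ this.2⟩
  · simp at hx

-- Given the samples, the output is deterministic by `hk`. Hence the success probability is at least
-- the average of the success indicator over all lists.
open Classical in
lemma sampleMany_spec [Nonempty A] {K : ℕ} {qf : List A → ℚ}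
    (hk : ∀ l : List A, l.length = K → ∀ σ : State (A ⊕ B), Sampled l σ →
      Outputs w env (k (numbers l σ)) σ (qf l) n)
    (r : ℕ) (l : List A) (hl : l.length + r = K) (σ : State (A ⊕ B)) (hσ : Sampled l σ) :
    (∀ o ∈ ((sampleMany z r (numbers l σ) k).run w env σ).support, o.2 ≤ n + r) ∧
    ∀ good : ℚ → Prop, ENNReal.ofReal (avgList r fun l' => if good (qf (l ++ l')) then 1 else 0) ≤
      ((sampleMany z r (numbers l σ) k).run w env σ).toOuterMeasure {o | good o.1} := by
  induction r generalizing l σ with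
  | zero =>
    have h := hk l (by simpa using hl) σ hσ
    refine ⟨fun o ho => (h o ho).2, fun good => ?_⟩
    simp only [avgList, List.append_nil, sampleMany]
    split_ifs with hg
    · rw [ENNReal.ofReal_one, (PMF.toOuterMeasure_apply_eq_one_iff _ _).2]
      intro o ho
      simp only [Set.mem_ofPred_eq, (h o ho).1, hg]
    · simp
  | succ r ih =>
    have ih' := fun a => ih (l ++ [a]) (by simp; omega) _ (hσ.concat a)
    constructor
    · intro o ho
      simp only [sampleMany, Prog.run, PMF.mem_support_bind_iff, PMF.mem_support_map_iff,
        draw_support] at ho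
      obtain ⟨x, (⟨rfl, hx⟩ | ⟨x, hx, rfl⟩), o', ho', rfl⟩ := ho
      · simp [Finset.univ_eq_empty_iff] at hx
      · simp only [Finset.mem_map, Finset.mem_univ, true_and, Function.Embedding.inl_apply] at hx
        obtain ⟨a, rfl⟩ := hx
        have := (ih' a).1 o'
        rw [hσ.numbers_concat] at this
        exact Nat.succ_le_succ (this ho')
    · intro good
      have hN : (0 : ℝ) < Fintype.card A := by exact_mod_cast Fintype.card_pos
      have hne : (Finset.univ.map (Function.Embedding.inl : A ↪ A ⊕ B)).Nonempty := by simp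
      simp only [sampleMany, Prog.run, draw, dif_pos hne]
      rw [PMF.bind_map, PMF.toOuterMeasure_bind_apply, tsum_fintype, Fintype.sum_sum_type]
      refine le_trans ?_ (le_add_of_nonneg_right zero_le)
      simp only [avgList]
      rw [Finset.sum_div, ENNReal.ofReal_sum_of_nonneg fun a _ => div_nonneg
        (avgList_nonneg _ fun l => by split_ifs <;> norm_num) hN.le]
      refine Finset.sum_le_sum fun a _ => ?_
      rw [PMF.uniformOfFinset_apply_of_mem _ (by simp), Finset.card_map, Finset.card_univ,
        ENNReal.ofReal_div_of_pos hN, ENNReal.ofReal_natCast, div_eq_mul_inv, mul_comm]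
      gcongr
      rw [Function.comp_apply, PMF.toOuterMeasure_map_apply]
      have := (ih' a).2 good
      rw [hσ.numbers_concat] at this
      simp only [List.append_assoc, List.singleton_append] at this
      exact this

end Sample

/-! ### The estimator -/

/-! ### The matching on a bipartite graph -/

section Bipartite

variable {A B : Type*} [Fintype A] [Fintype B] {w : A → B → ℕ} {S : Finset ℕ}

lemma mem_wNbrs_comm (w : A → B → ℕ) (s : ℕ) (x y : A ⊕ B) :
    x ∈ wNbrs w y s ↔ y ∈ wNbrs w x s := by
  cases x <;> cases y <;> simp [wNbrs]

lemma edgeSum_inl (a : A) (F : A ⊕ B → ℕ → ℚ) :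
    edgeSum S (wNbrs w) (Sum.inl a) F = ∑ b, if w a b ∈ S then F (Sum.inr b) (w a b) else 0 := by
  simp only [edgeSum, wNbrs, Finset.sum_map, Function.Embedding.inr_apply, Finset.sum_filter]
  rw [Finset.sum_comm]
  refine Finset.sum_congr rfl fun b _ => ?_
  rw [Finset.sum_ite_eq S (w a b) fun s => F (Sum.inr b) s]

lemma edgeSum_inr (b : B) (F : A ⊕ B → ℕ → ℚ) :
    edgeSum S (wNbrs w) (Sum.inr b) F = ∑ a, if w a b ∈ S then F (Sum.inl a) (w a b) else 0 := by
  simp only [edgeSum, wNbrs, Finset.sum_map, Function.Embedding.inl_apply, Finset.sum_filter]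
  rw [Finset.sum_comm]
  refine Finset.sum_congr rfl fun a _ => ?_
  rw [Finset.sum_ite_eq S (w a b) fun s => F (Sum.inl a) s]

/-- The summand 1 ensures `1 ≤ Δ` even for `d = 0`. -/
lemma edgeSum_one_le {d : ℕ} (h : ∀ s ∈ S, ∀ x, wDeg w x s ≤ d) (x : A ⊕ B) :
    edgeSum S (wNbrs w) x (fun _ _ => 1) ≤ S.card * d + 1 := by
  have : edgeSum S (wNbrs w) x (fun _ _ => 1) ≤ ∑ s ∈ S, (d : ℚ) := by
    refine Finset.sum_le_sum fun s hs => ?_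
    rw [Finset.sum_const, nsmul_eq_mul, mul_one]
    exact_mod_cast h s hs x
  rw [Finset.sum_const, nsmul_eq_mul] at this
  linarith

/-- The fractional matching computed by the subgradient method. -/
def matching (S : Finset ℕ) (w : A → B → ℕ) (η : ℚ) (T : ℕ) (a : A) (b : B) : ℚ :=
  if w a b ∈ S then scaledFlow S (wNbrs w) η T (Sum.inl a) (Sum.inr b) (w a b) else 0

variable {η : ℚ} {T : ℕ}

lemma matching_nonneg (a : A) (b : B) : 0 ≤ matching S w η T a b := by
  unfold matching
  split_ifs
  exacts [scaledFlow_nonneg _ _ _, le_rfl]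

lemma sum_matching_left (a : A) : ∑ b, matching S w η T a b ≤ 1 := by
  have := edgeSum_scaledFlow_le_one (S := S) (nb := wNbrs w) (η := η) (T := T) (Sum.inl a)
  rwa [edgeSum_inl] at this

lemma sum_matching_right (b : B) : ∑ a, matching S w η T a b ≤ 1 := by
  have := edgeSum_scaledFlow_le_one (S := S) (nb := wNbrs w) (η := η) (T := T) (Sum.inr b)
  rw [edgeSum_inr] at this
  simpa only [matching, scaledFlow_comm (Sum.inl _)] using this

lemma localGain_inl (a : A) : localGain S (wNbrs w) η T (Sum.inl a) =
    ∑ b, (3 - (w a b : ℚ)) * matching S w η T a b := by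
  rw [localGain, edgeSum_inl]
  refine Finset.sum_congr rfl fun b _ => ?_
  unfold matching
  split_ifs <;> simp

/-- Every edge is counted once on each side, so sampling left nodes suffices. -/
lemma sum_localGain : ∑ x : A ⊕ B, localGain S (wNbrs w) η T x =
    2 * ∑ a, localGain S (wNbrs w) η T (Sum.inl a) := by
  have h : ∀ b, localGain S (wNbrs w) η T (Sum.inr b) =
      ∑ a, (3 - (w a b : ℚ)) * matching S w η T a b := by
    intro b
    rw [localGain, edgeSum_inr]
    refine Finset.sum_congr rfl fun a _ => ?_
    unfold matching
    split_ifs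
    · rw [scaledFlow_comm]
    · simp
  rw [Fintype.sum_sum_type, Finset.sum_congr rfl fun b _ => h b, Finset.sum_comm,
    Finset.sum_congr rfl fun a _ => localGain_inl a]
  ring

end Bipartite

/-! ### Estimating the average gain -/

section Estimator

/-- Bound on the numbers of the nodes at distance `i` from `K` initially known nodes. -/
def levelBound (K f : ℕ) : ℕ → ℕ
  | 0 => K
  | i + 1 => K + f * levelBound K f i

lemma levelBound_mono (K f : ℕ) : Monotone (levelBound K f) := by
  refine monotone_nat_of_le_succ fun i => ?_
  induction i with
  | zero => exact Nat.le_add_right _ _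
  | succ i ih => exact Nat.add_le_add_left (Nat.mul_le_mul_left f ih) K

/-- For all nodes with numbers less than `M`, find the neighbours for the weights in `S`. -/
def taskList (S : Finset ℕ) (M : ℕ) : List (ℕ × ℕ) := (List.range M).product S.toList

lemma mem_taskList {S : Finset ℕ} {M i s : ℕ} : (i, s) ∈ taskList S M ↔ i < M ∧ s ∈ S := by
  simp [taskList]

lemma taskList_nodup (S : Finset ℕ) (M : ℕ) : (taskList S M).Nodup :=
  List.nodup_range.product S.nodup_toList

lemma taskList_pairwise (S : Finset ℕ) (M : ℕ) :
    (taskList S M).Pairwise fun a b => a.1 ≤ b.1 := by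
  unfold taskList
  rw [List.product, List.pairwise_flatMap]
  refine ⟨fun i _ => ?_, ?_⟩
  · rw [List.pairwise_map]
    exact List.pairwise_of_forall fun _ _ => le_rfl
  · refine List.pairwise_lt_range.imp fun {i j} hij a ha b hb => ?_
    obtain ⟨_, _, rfl⟩ := List.mem_map.1 ha
    obtain ⟨_, _, rfl⟩ := List.mem_map.1 hb
    exact hij.le

lemma countP_taskList_le (S : Finset ℕ) (M b : ℕ) :
    (taskList S M).countP (fun a => a.1 < b) ≤ S.card * b := by
  rw [List.countP_eq_length_filter,
    ← List.toFinset_card_of_nodup ((taskList_nodup S M).filter _)]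
  have : ((taskList S M).filter fun a => a.1 < b).toFinset ⊆ Finset.range b ×ˢ S := by
    rintro ⟨i, s⟩ h
    simp only [List.mem_toFinset, List.mem_filter, mem_taskList, decide_eq_true_eq] at h
    simp [h]
  refine (Finset.card_le_card this).trans ?_
  rw [Finset.card_product, Finset.card_range, mul_comm]

/-- Explore the graph around the known nodes, and output an expression depending on the average
gain of the nodes with the numbers in `acc`. -/
def exploreAndOutput (S : Finset ℕ) (d : ℕ) (η : ℚ) (T K : ℕ) (e : ℚ → Expr) (acc : List ℕ) :
    Prog :=
  explore d (taskList S (levelBound K (d * S.card) (T + 2))) (fun _ _ => ∅) fun tbl =>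
    .output (e ((acc.map (localGain S tbl η T)).sum / K))

/-- Estimate the average gain of the nodes on the left side by `K` samples. -/
def estimator (S : Finset ℕ) (d : ℕ) (η : ℚ) (T K : ℕ) (e : ℚ → Expr) : Prog :=
  sampleMany (.output (e 0)) K [] (exploreAndOutput S d η T K e)

/-- Instruction bound of `exploreAndOutput`. -/
def explorationCost (S : Finset ℕ) (d T K : ℕ) : ℕ :=
  0 + d * (taskList S (levelBound K (d * S.card) (T + 2))).length

variable {A B : Type*} [Fintype A] [Fintype B] [DecidableEq A] [DecidableEq B]
  {w : A → B → ℕ} {env : Fin 3 → ℚ} {S : Finset ℕ} {d : ℕ} {η : ℚ} {T K : ℕ} {e : ℚ → Expr}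

lemma outputs_estimate (hdeg : ∀ s ∈ S, ∀ x, wDeg w x s ≤ d) {l : List A} (hl : l.length = K)
    {σ : State (A ⊕ B)} (hσ : Sampled l σ) :
    Outputs w env (exploreAndOutput S d η T K e (numbers l σ)) σ
      ((e ((l.map fun a => localGain S (wNbrs w) η T (Sum.inl a)).sum / K)).eval env)
      (explorationCost S d T K) := by
  unfold exploreAndOutput explorationCost
  set M := levelBound K (d * S.card) (T + 2) with hM
  refine outputs_explore _ (fun i s h x => hdeg s (mem_taskList.1 h).2 x) σ _ hσ.nodup
    (taskList_nodup S M) (taskList_pairwise S M) (fun x _ s => hσ.answered x s)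
    (fun _ s _ x _ => hσ.answered x s) fun σ' tbl h1 h2 _ _ h5 => ?_
  -- The number of `x` is within the bound for level `i`, and `j` is the radius still available
  -- around it. Sampled nodes have numbers below `K`, hence level 0.
  set P : ℕ → A ⊕ B → Prop := fun j x => ∃ i, i + j = T + 2 ∧ x ∈ σ'.seen ∧
    index σ'.seen x < levelBound K (d * S.card) i with hP
  have hcorrect : CorrectTable S (wNbrs w) tbl (index σ'.seen) P := by
    rintro j x ⟨i, hij, hx, hi⟩
    refine ⟨⟨i + 1, by omega, hx, hi.trans_le (levelBound_mono _ _ (Nat.le_succ i))⟩,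
      fun s hs => ?_⟩
    have hiM : index σ'.seen x < M := hi.trans_le (levelBound_mono _ _ (by omega))
    obtain ⟨g1, g2, g3⟩ := h5 _ s (mem_taskList.2 ⟨hiM, hs⟩) x (getElem?_index hx)
    refine ⟨g2, (index_injOn _).mono fun z hz => List.mem_toFinset.1 (g1 hz), fun z hz =>
      ⟨i + 1, by omega, List.mem_toFinset.1 (g1 hz), (g3 _ hi z hz).trans_le ?_⟩⟩
    rw [levelBound, mul_assoc, ← hl]
    exact Nat.add_le_add hσ.length (Nat.mul_le_mul_left d (countP_taskList_le S M _))
  have hval : (numbers l σ).map (localGain S tbl η T) =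
      l.map fun a => localGain S (wNbrs w) η T (Sum.inl a) := by
    rw [numbers, List.map_map]
    refine List.map_congr_left fun a ha => ?_
    have hmem := hσ.mem a ha
    rw [Function.comp_apply, ← index_eq_of_prefix h1 hmem]
    refine hcorrect.localGain_eq ⟨0, by omega, h1.subset hmem, ?_⟩
    rw [index_eq_of_prefix h1 hmem]
    exact (index_lt_length hmem).trans_le (hσ.length.trans hl.le)
  rw [hval]
  exact outputs_output _ _

open Classical in
lemma estimator_spec [Nonempty A] (hdeg : ∀ s ∈ S, ∀ x, wDeg w x s ≤ d) :
    (∀ o ∈ ((estimator S d η T K e).run w env (State.init [])).support,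
      o.2 ≤ explorationCost S d T K + K) ∧
    ∀ good : ℚ → Prop, ENNReal.ofReal (avgList K fun l : List A =>
      if good ((e ((l.map fun a => localGain S (wNbrs w) η T (Sum.inl a)).sum / K)).eval env)
        then 1 else 0) ≤
      ((estimator S d η T K e).run w env (State.init [])).toOuterMeasure {o | good o.1} :=
  sampleMany_spec (z := .output (e 0)) (k := exploreAndOutput S d η T K e) (env := env)
    (qf := fun l : List A =>
      (e ((l.map fun a => localGain S (wNbrs w) η T (Sum.inl a)).sum / K)).eval env)
    (fun _ hl _ hσ => outputs_estimate hdeg hl hσ) K [] (Nat.zero_add K) (State.init [])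
    Sampled.init

lemma estimator_cost (hdeg : ∀ s ∈ S, ∀ x, wDeg w x s ≤ d) (hK : K ≠ 0) :
    ∀ o ∈ ((estimator S d η T K e).run w env (State.init [])).support,
      o.2 ≤ explorationCost S d T K + (K + 1) := by
  intro o ho
  rcases isEmpty_or_nonempty A with hA | hA
  · obtain ⟨r, rfl⟩ := Nat.exists_eq_succ_of_ne_zero hK
    have := (outputs_sampleMany_of_isEmpty (outputs_output (e 0) 0) r [] o ho).2
    omega
  · have := (estimator_spec hdeg).1 o ho
    omega

lemma estimator_good (hdeg : ∀ s ∈ S, ∀ x, wDeg w x s ≤ d) (hS : ∀ s ∈ S, 1 ≤ s ∧ s ≤ 3)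
    {ε : ℚ} (hε : 0 < ε) (hK : 12 ≤ (K : ℝ) * (ε : ℝ) ^ 2) {good : ℚ → Prop}
    (hgood : ∀ q : ℚ,
      |q * Fintype.card A - ∑ a, localGain S (wNbrs w) η T (Sum.inl a)| ≤ ε * Fintype.card A →
      good ((e q).eval env)) :
    2 / 3 ≤ ((estimator S d η T K e).run w env (State.init [])).toOuterMeasure
      {o | good o.1} := by
  classical
  have hK0 : K ≠ 0 := by
    rintro rfl
    norm_num at hK
  rcases isEmpty_or_nonempty A with hA | hA
  · obtain ⟨r, rfl⟩ := Nat.exists_eq_succ_of_ne_zero hK0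
    have hone : ((estimator S d η T (r + 1) e).run w env (State.init [])).toOuterMeasure
        {o | good o.1} = 1 := by
      refine (PMF.toOuterMeasure_apply_eq_one_iff _ _).2 fun o ho => ?_
      have := (outputs_sampleMany_of_isEmpty (outputs_output (e 0) 0) r [] o ho).1
      rw [Set.mem_ofPred_eq, this]
      -- Without left nodes there are no edges, and the estimate 0 is exact.
      exact hgood 0 (by simp)
    rw [Nat.succ_eq_add_one, hone]
    exact ENNReal.div_le_of_le_mul (by norm_num)
  · have h1 := (estimator_spec (env := env) (e := e) (η := η) (T := T) (K := K) hdeg).2 good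
    refine le_trans ?_ h1
    have hg0 : ∀ a : A, (0 : ℝ) ≤ (localGain S (wNbrs w) η T (Sum.inl a) : ℚ) := fun a =>
      Rat.cast_nonneg.2 (localGain_nonneg (fun s hs => (hS s hs).2) _)
    have hg2 : ∀ a : A, ((localGain S (wNbrs w) η T (Sum.inl a) : ℚ) : ℝ) ≤ 2 := fun a => by
      have h := localGain_le_two (nb := wNbrs w) (η := η) (T := T) (fun s hs => (hS s hs).1)
        (Sum.inl a)
      exact_mod_cast h
    have h2 := two_thirds_le_avgList hg0 hg2 (Rat.cast_pos.2 hε) hK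
    have h3 : (2 / 3 : ENNReal) = ENNReal.ofReal (2 / 3) := by
      rw [ENNReal.ofReal_div_of_pos (by norm_num)]; simp
    rw [h3]
    refine ENNReal.ofReal_le_ofReal (h2.trans (avgList_mono K fun l hl => ?_))
    have hN : (0 : ℝ) < Fintype.card A := by exact_mod_cast Fintype.card_pos
    split_ifs with g1 g2 g2
    · exact le_rfl
    · refine absurd (hgood _ ?_) g2
      have e1 : (l.map fun a => ((localGain S (wNbrs w) η T (Sum.inl a) : ℚ) : ℝ)).sum =
          (((l.map fun a => localGain S (wNbrs w) η T (Sum.inl a)).sum : ℚ) : ℝ) := by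
        rw [Rat.cast_list_sum, List.map_map]; rfl
      rw [e1] at g1
      have g3 := mul_le_mul_of_nonneg_right g1 hN.le
      rw [← abs_of_pos hN, ← abs_mul, abs_of_pos hN, sub_mul, div_mul_cancel₀ _ hN.ne'] at g3
      exact_mod_cast g3
    · norm_num
    · exact le_rfl

end Estimator

section Graph

variable {V : Type*} [Fintype V] [DecidableEq V] {G : SimpleGraph V} [DecidableRel G.Adj] {u v : V}

/-! ### The balanced graph -/

/-- Bounded degrees of `G_{u,v}` for a weight in `{1, 2}` bound the number of copies. -/
lemma copies_le (huv : G.Adj u v) {d j : ℕ} (hj : j = 1 ∨ j = 2)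
    (hd : ∀ x, wDeg (guvWeight G u v) x j ≤ d) :
    (G.degree v + 1) / (G.degree u + 1) ≤ d + 1 := by
  have key : G.degree v + 1 ≤ (d + 1) * (G.degree u + 1) := by
    rcases hj with rfl | rfl
    -- The node `v` of `N[u]` has weight 1 to all its neighbours, so `deg v ≤ d`.
    · have h := hd (Sum.inl ⟨v, by simp [huv]⟩)
      have h2 : G.degree v ≤ wDeg (guvWeight G u v) (Sum.inl ⟨v, by simp [huv]⟩) 1 := by
        rw [wDeg, wNbrs, Finset.card_map, ← SimpleGraph.card_neighborFinset_eq_degree]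
        refine Finset.card_le_card_of_surjOn (fun y => y.1) fun y hy => ?_
        have hy' : G.Adj v y := by simpa using hy
        exact ⟨⟨y, by simp [hy']⟩, by simp [guvWeight, SimpleGraph.dist_eq_one_iff_adj, hy'], rfl⟩
      nlinarith
    -- Nodes of `N[v]` outside `N[u]` are at distance exactly 2 from `u`, so `deg v ≤ deg u + d`.
    · have h := hd (Sum.inl ⟨u, by simp⟩)
      have h2 : (insert v (G.neighborFinset v) \ insert u (G.neighborFinset u)).card ≤
          wDeg (guvWeight G u v) (Sum.inl ⟨u, by simp⟩) 2 := by
        rw [wDeg, wNbrs, Finset.card_map]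
        refine Finset.card_le_card_of_surjOn (fun y => y.1) fun y hy => ?_
        have hy' := Finset.mem_sdiff.1 (Finset.mem_coe.1 hy)
        refine ⟨⟨y, hy'.1⟩, Finset.mem_coe.2 (Finset.mem_filter.2 ⟨Finset.mem_univ _, ?_⟩), rfl⟩
        have hne : u ≠ y := fun e => hy'.2 (by simp [e])
        have hnadj : ¬G.Adj u y := fun e => hy'.2 (by simp [e])
        have hr := reachable_of_mem_closedNbr huv (x := u) (by simp) hy'.1
        have h1 := hr.one_lt_dist_of_ne_of_not_adj hne hnadj
        have h3 := huv.reachable.dist_triangle_left y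
        have h4 := dist_le_one_of_mem_closedNbr hy'.1
        have h5 := SimpleGraph.dist_eq_one_iff_adj.2 huv
        rw [G.dist_comm (u := y)] at h4
        change G.dist u y = 2
        omega
      have h3 := Finset.le_card_sdiff (insert u (G.neighborFinset u))
        (insert v (G.neighborFinset v))
      rw [Finset.card_insert_of_notMem (by simp), Finset.card_insert_of_notMem (by simp),
        SimpleGraph.card_neighborFinset_eq_degree, SimpleGraph.card_neighborFinset_eq_degree] at h3
      have h4 : G.degree v ≤ G.degree u + d := by omega
      nlinarith
  exact Nat.div_le_of_le_mul (by rwa [mul_comm] at key)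

lemma wDeg_balancedWeight_le (huv : G.Adj u v) {d j : ℕ} (hj : j = 1 ∨ j = 2)
    (hd : ∀ x, wDeg (guvWeight G u v) x j ≤ d)
    (x : BalancedLeft G u v ⊕ ClosedNbr G v) :
    wDeg (balancedWeight G u v) x j ≤ (d + 1) * d := by
  have hdd : d ≤ (d + 1) * d := by nlinarith
  rcases x with (⟨x, i⟩ | i) | y
  · have := hd (Sum.inl x)
    rw [wDeg, wNbrs, Finset.card_map] at this ⊢
    exact this.trans hdd
  · have : (3 : ℕ) ≠ j := by rcases hj with rfl | rfl <;> norm_num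
    simp [wDeg, wNbrs, balancedWeight, this]
  · have h := hd (Sum.inr y)
    rw [wDeg, wNbrs, Finset.card_map] at h ⊢
    have h3 : (3 : ℕ) ≠ j := by rcases hj with rfl | rfl <;> norm_num
    have hsub : (Finset.univ.filter fun a => balancedWeight G u v a y = j) ⊆
        ((Finset.univ.filter fun a => guvWeight G u v a y = j) ×ˢ
          (Finset.univ : Finset (Fin ((G.degree v + 1) / (G.degree u + 1))))).map
          Function.Embedding.inl := by
      rintro (⟨a, i⟩ | i) ha
      · have ha' : guvWeight G u v a y = j := (Finset.mem_filter.1 ha).2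
        exact Finset.mem_map.2 ⟨(a, i), Finset.mem_product.2
          ⟨Finset.mem_filter.2 ⟨Finset.mem_univ _, ha'⟩, Finset.mem_univ _⟩, rfl⟩
      · exact absurd (Finset.mem_filter.1 ha).2 h3
    refine (Finset.card_le_card hsub).trans ?_
    rw [Finset.card_map, Finset.card_product, Finset.card_univ, Fintype.card_fin, mul_comm]
    exact Nat.mul_le_mul (copies_le huv hj hd) h

/-! ### Correctness of the estimate -/

/-- The output for the estimate `q` of the average gain. -/
def outputExpr (ε q : ℚ) : Expr :=
  .sub (.const (1 - ε)) (.div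
    (.sub (.mul (.const 3) (.sub (.sub (.var 1) (.var 2)) (.const 1)))
      (.mul (.const q) (.sub (.sub (.var 0) (.var 2)) (.const 1))))
    (.add (.const 1) (.var 1)))

lemma outputExpr_eval (huv : G.Adj u v) (ε q : ℚ) :
    (outputExpr ε q).eval (knownNumbers G u v) =
      1 - ε - (3 * Fintype.card (HRight G u v) - q * Fintype.card (HLeft G u v)) /
        (1 + G.degree v) := by
  simp only [card_HRight huv, card_HLeft huv]
  simp [outputExpr, Expr.eval, knownNumbers]

/-- Correctness of the output, if the distances in `H` are at least `K` minus `c` times the gain. -/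
lemma isAdditiveApprox_of_estimate (huv : G.Adj u v) (hdeg : G.degree u ≤ G.degree v) {δ : ℝ}
    (hδ : (1 - δ / 3) * (G.degree v : ℝ) ≤ (G.degree u : ℝ)) (hδ0 : 0 < δ)
    {S : Finset ℕ} (hS : ∀ s ∈ S, 1 ≤ s ∧ s ≤ 3) {K c : ℝ} (hc0 : 0 ≤ c) (hc1 : c ≤ 1)
    (hK0 : 0 ≤ K) (hK3 : K ≤ 3)
    (hKS : ∀ s ∈ S, K - s ≤ c * (3 - s)) (hKS' : ∀ s ∉ S, 1 ≤ s → K ≤ (s : ℝ))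
    {d : ℕ} (hd : ∀ s ∈ S, ∀ x, wDeg (hWeight G u v) x s ≤ d) {η ε : ℚ} {T : ℕ} (hη : 0 < η)
    (hT : T ≠ 0) (hε : 0 < ε)
    (herr : 2 / (η * T) + η * (S.card * d + 1 : ℚ) ^ 2 / 2 ≤ ε) {q : ℚ}
    (hq : |q * Fintype.card (HLeft G u v) -
      ∑ a, localGain S (wNbrs (hWeight G u v)) η T (Sum.inl a)| ≤
        ε * Fintype.card (HLeft G u v)) {r : ℝ} (hr : 3 - K + 4 * ε + δ ≤ r) :
    IsAdditiveApprox G u v r (((outputExpr ε q).eval (knownNumbers G u v) : ℚ) : ℝ) := by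
  set w := hWeight G u v with hw
  set L : ℝ := ((Fintype.card (HLeft G u v) : ℕ) : ℝ) with hL
  set R : ℝ := ((Fintype.card (HRight G u v) : ℕ) : ℝ) with hR
  set n : ℝ := 1 + G.degree v with hn
  have hn0 : 0 < n := by positivity
  have hL0 : 0 ≤ L := Nat.cast_nonneg _
  have hR0 : 0 ≤ R := Nat.cast_nonneg _
  have hLn : L ≤ n := by
    have h1 : ((Fintype.card (HLeft G u v) : ℚ) : ℝ) = L := by simp [hL]
    rw [card_HLeft huv] at h1
    push_cast at h1
    have h2 : (G.degree u : ℝ) ≤ G.degree v := by exact_mod_cast hdeg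
    have h3 : (0 : ℝ) ≤ ((G.neighborFinset u ∩ G.neighborFinset v).card : ℝ) := Nat.cast_nonneg _
    linarith
  have hRn : R ≤ n := by
    have h1 : ((Fintype.card (HRight G u v) : ℚ) : ℝ) = R := by simp [hR]
    rw [card_HRight huv] at h1
    push_cast at h1
    have h3 : (0 : ℝ) ≤ ((G.neighborFinset u ∩ G.neighborFinset v).card : ℝ) := Nat.cast_nonneg _
    linarith
  have hε' : (0 : ℝ) < ε := Rat.cast_pos.2 hε
  set Xq : ℚ := ∑ a, localGain S (wNbrs w) η T (Sum.inl a) with hXq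
  obtain ⟨y, hy0, hyS, hysum⟩ := exists_dual_of_localGain (S := S) (nb := wNbrs w) (η := η) (T := T)
    (fun s _ x z => mem_wNbrs_comm w s x z) (fun s hs => (hS s hs).1)
    (le_add_of_nonneg_left (by positivity)) (edgeSum_one_le hd) hη hT
  have hysum' : ((∑ x, y x : ℚ) : ℝ) ≤ (Xq : ℝ) + (L + R) * ε := by
    have h1 : (∑ x, y x) ≤ Xq + (Fintype.card (HLeft G u v ⊕ HRight G u v) : ℚ) * ε := by
      refine hysum.trans (add_le_add ?_ (mul_le_mul_of_nonneg_left herr (Nat.cast_nonneg _)))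
      rw [sum_localGain]
      exact (by ring : 2 * Xq / 2 = Xq).le
    rw [Fintype.card_sum] at h1
    have h2 : ((∑ x, y x : ℚ) : ℝ) ≤
        ((Xq + ((Fintype.card (HLeft G u v) + Fintype.card (HRight G u v) : ℕ) : ℚ) * ε : ℚ) : ℝ) :=
      Rat.cast_le.2 h1
    push_cast at h2 ⊢
    exact h2
  have hX : ∑ l, ∑ r, (3 - (w l r : ℝ)) * (matching S w η T l r : ℝ) = (Xq : ℝ) := by
    rw [hXq]
    simp only [localGain_inl]
    push_cast
    rfl
  have hupper := one_sub_curvature_le huv hdeg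
    (X := fun l r => ((matching S w η T l r : ℚ) : ℝ))
    (fun l r => Rat.cast_nonneg.2 (matching_nonneg l r))
    (fun l => by exact_mod_cast sum_matching_left (w := w) (S := S) (η := η) (T := T) l)
    (fun r => by exact_mod_cast sum_matching_right (w := w) (S := S) (η := η) (T := T) r)
  rw [← hw, hX] at hupper
  have hlower := le_one_sub_curvature huv hdeg (K := K) (yl := fun l => c * (y (Sum.inl l) : ℚ))
    (yr := fun r => c * (y (Sum.inr r) : ℚ))
    (fun r => mul_nonneg hc0 (Rat.cast_nonneg.2 (hy0 _))) (fun l r => by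
      have hy1 : (0 : ℝ) ≤ c * (y (Sum.inl l) : ℚ) := mul_nonneg hc0 (Rat.cast_nonneg.2 (hy0 _))
      have hy2 : (0 : ℝ) ≤ c * (y (Sum.inr r) : ℚ) := mul_nonneg hc0 (Rat.cast_nonneg.2 (hy0 _))
      by_cases hs : w l r ∈ S
      · have h1 := hyS _ hs (Sum.inl l) (Sum.inr r) (by simp [wNbrs])
        have h2 : (3 : ℝ) - (w l r : ℝ) ≤ (y (Sum.inl l) : ℚ) + (y (Sum.inr r) : ℚ) := by
          exact_mod_cast h1
        have h3 := mul_le_mul_of_nonneg_left h2 hc0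
        have h4 := hKS _ hs
        linarith
      · have h1 : 1 ≤ w l r := by
          refine (reachable_of_mem_closedNbr huv (HLeft_subset l.2)
            (HLeft_subset r.2)).pos_dist_of_ne fun e => ?_
          exact HLeft_notMem huv l (e ▸ HLeft_subset r.2)
        have h2 := hKS' _ hs h1
        linarith)
  have hY : ∑ l : HLeft G u v, c * ((y (Sum.inl l) : ℚ) : ℝ) +
      ∑ r : HRight G u v, c * ((y (Sum.inr r) : ℚ) : ℝ) = c * ((∑ x, y x : ℚ) : ℝ) := by
    rw [Fintype.sum_sum_type, ← Finset.mul_sum, ← Finset.mul_sum]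
    push_cast
    ring
  rw [sub_sub, hY] at hlower
  set Y : ℝ := ((∑ x, y x : ℚ) : ℝ) with hYdef
  have hY0 : 0 ≤ Y := Rat.cast_nonneg.2 (Finset.sum_nonneg fun x _ => hy0 x)
  have hq' : |(q : ℝ) * L - Xq| ≤ ε * L := by
    have : ((|q * Fintype.card (HLeft G u v) - Xq| : ℚ) : ℝ) ≤
        ((ε * Fintype.card (HLeft G u v) : ℚ) : ℝ) := Rat.cast_le.2 hq
    push_cast at this
    exact this
  obtain ⟨hq1, hq2⟩ := abs_le.1 hq'
  have hout : (((outputExpr ε q).eval (knownNumbers G u v) : ℚ) : ℝ) =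
      1 - ε - (3 * R - q * L) / n := by
    rw [outputExpr_eval huv]
    push_cast
    rfl
  have hεL : ε * L ≤ ε * n := mul_le_mul_of_nonneg_left hLn hε'.le
  have hεR : ε * R ≤ ε * n := mul_le_mul_of_nonneg_left hRn hε'.le
  rw [IsAdditiveApprox, hout]
  constructor
  -- The `ε` subtracted in the output absorbs the sampling error and makes the approximation
  -- one-sided.
  · have h1 : (3 * R - Xq) / n ≤ (3 * R - q * L) / n + ε := by
      rw [div_add' _ _ _ hn0.ne']
      exact div_le_div_of_nonneg_right (by linarith) hn0.le
    linarith
  · have hgap : (((G.degree v : ℝ) - G.degree u) / n) ≤ δ / 3 := by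
      rw [div_le_iff₀ hn0]
      nlinarith
    have h1 : K * (((G.degree v : ℝ) - G.degree u) / n) ≤ δ := by
      have := mul_le_mul_of_nonneg_left hgap hK0
      nlinarith
    -- One `ε` is the sampling error and two come from the duality gap `(L + R) ε`; `3 - K` pays for
    -- replacing `3 R` by `K R`.
    have h2 : (3 * R - q * L) / n ≤ (K * R - c * Y) / n + (3 - K) + 3 * ε := by
      rw [div_add' _ _ _ hn0.ne', div_add' _ _ _ hn0.ne']
      refine div_le_div_of_nonneg_right ?_ hn0.le
      have h3 : (3 - K) * R ≤ (3 - K) * n := mul_le_mul_of_nonneg_left hRn (by linarith)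
      have h4 : c * Y ≤ 1 * Y := mul_le_mul_of_nonneg_right hc1 hY0
      linarith
    linarith

end Graph

/-- Existence of a local algorithm, for weights `S` of bounded degree. -/
lemma exists_approximates (S : Finset ℕ) (hS : ∀ s ∈ S, 1 ≤ s ∧ s ≤ 3) {K c : ℝ} (hc0 : 0 ≤ c)
    (hc1 : c ≤ 1) (hK0 : 0 ≤ K) (hK3 : K ≤ 3) (hKS : ∀ s ∈ S, K - s ≤ c * (3 - s))
    (hKS' : ∀ s ∉ S, 1 ≤ s → K ≤ (s : ℝ)) (d : ℕ) {ε δ : ℝ} (hε : 0 < ε) (hδ : 0 < δ) {r : ℝ}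
    (hr : 3 - K + ε + δ ≤ r) :
    ∃ (T : ℕ) (p : Prog),
      ∀ (V : Type w) [Fintype V] [DecidableEq V] (G : SimpleGraph V) [DecidableRel G.Adj]
        (u v : V), G.Adj u v → G.degree u ≤ G.degree v →
        (1 - δ / 3) * (G.degree v : ℝ) ≤ (G.degree u : ℝ) →
        (∀ s ∈ S, ∀ x, wDeg (hWeight G u v) x s ≤ d) → p.Approximates G u v T r := by
  obtain ⟨e, he0, he⟩ := exists_rat_btwn (show (0 : ℝ) < ε / 4 by positivity)
  have he0' : 0 < e := Rat.cast_pos.1 he0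
  set Δ : ℚ := S.card * d + 1 with hΔ
  have hΔ0 : 0 < Δ := by positivity
  -- This step size makes the second error term `e / 2`; `T` is then large enough to make the first
  -- at most `e / 2`.
  set η : ℚ := e / Δ ^ 2 with hη
  have hη0 : 0 < η := by positivity
  obtain ⟨T, hT⟩ := exists_nat_gt (4 / (η * e))
  have hT0 : (0 : ℚ) < T := lt_trans (by positivity) hT
  have hTne : T ≠ 0 := by rintro rfl; simp at hT0
  have herr : 2 / (η * T) + η * Δ ^ 2 / 2 ≤ e := by
    have h1 : η * Δ ^ 2 = e := by rw [hη]; field_simp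
    have h2 : 2 / (η * T) ≤ e / 2 := by
      rw [div_lt_iff₀ (by positivity)] at hT
      rw [div_le_iff₀ (by positivity)]
      nlinarith
    rw [h1]
    linarith
  obtain ⟨m, hm⟩ := exists_nat_gt (12 / (e : ℝ) ^ 2)
  have hm12 : 12 ≤ (m : ℝ) * (e : ℝ) ^ 2 := by
    rw [div_lt_iff₀ (by positivity)] at hm
    exact hm.le
  have hm0 : m ≠ 0 := by rintro rfl; norm_num at hm12
  refine ⟨explorationCost S d T m + (m + 1), estimator S d η T m (outputExpr e), ?_⟩
  intro V _ _ G _ u v huv hdeg hδdeg hd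
  refine ⟨estimator_cost hd hm0, ?_⟩
  exact estimator_good (good := fun q => IsAdditiveApprox G u v r (q : ℝ)) hd hS he0' hm12
    fun q hq => isAdditiveApprox_of_estimate huv hdeg hδdeg hδ hS hc0 hc1 hK0 hK3 hKS hKS' hd hη0
      hTne he0' herr hq (by linarith)

/-- Selective degree queries by weighted neighbour queries. -/
lemma outputs_wDeg {A B : Type*} [Fintype A] [Fintype B] [DecidableEq A] [DecidableEq B]
    (w : A → B → ℕ) (env : Fin 3 → ℚ) (x : A ⊕ B) {j D : ℕ} (hD : wDeg w x j ≤ D) :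
    Outputs w env (collect 0 j D ∅ fun acc => .output (.const acc.card)) (State.init [x])
      (wDeg w x j) D := by
  have h := outputs_collect (w := w) (env := env) (q := (wDeg w x j : ℚ)) (n := 0) (i := 0) (s := j)
    (x := x) (k := fun acc => .output (.const acc.card)) D (State.init [x]) rfl
    (List.nodup_singleton x) (Finset.empty_subset _) (Finset.empty_subset _) hD
    fun σ' _ _ hsub _ _ => by
      have hcard : ((wNbrs w x j).image (index σ'.seen)).card = wDeg w x j :=
        Finset.card_image_of_injOn
          ((index_injOn _).mono fun z hz => List.mem_toFinset.1 (hsub hz))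
      rw [hcard]
      exact outputs_output _ _
  rw [zero_add] at h
  exact h

end RicciQuery

end

theorem mainTheorem5 (d : ℕ) (ε δ : ℝ) (hε : 0 < ε) (hδ : 0 < δ) :
    -- bounded weight-`j` degrees in `G_{u,v}` give bounded weight-`j` degrees in `G'_{u,v}`, and
    -- selective degree queries on `G'_{u,v}` are simulated by `O(1)` weighted neighbour queries
    (∀ j : ℕ, j = 1 ∨ j = 2 → ∃ (D : ℕ) (p : RicciQuery.Prog), p.OnlyWeight j ∧
      ∀ (V : Type w) [Fintype V] [DecidableEq V] (G : SimpleGraph V) [DecidableRel G.Adj]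
        (u v : V), G.Adj u v → G.degree u ≤ G.degree v →
        (1 - δ / 3) * (G.degree v : ℝ) ≤ (G.degree u : ℝ) →
        (∀ x, RicciQuery.wDeg (RicciQuery.guvWeight G u v) x j ≤ d) →
        ∀ x, RicciQuery.wDeg (RicciQuery.balancedWeight G u v) x j ≤ D ∧
          ∀ o ∈ (p.run (RicciQuery.balancedWeight G u v) (RicciQuery.knownNumbers G u v)
              (RicciQuery.State.init [x])).support,
            o.1 = (RicciQuery.wDeg (RicciQuery.balancedWeight G u v) x j : ℚ) ∧ o.2 ≤ D) ∧
    -- part (i)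
    (∃ (T : ℕ) (p : RicciQuery.Prog),
      ∀ (V : Type w) [Fintype V] [DecidableEq V] (G : SimpleGraph V) [DecidableRel G.Adj]
        (u v : V), G.Adj u v → G.degree u ≤ G.degree v →
        (1 - δ / 3) * (G.degree v : ℝ) ≤ (G.degree u : ℝ) →
        (∀ x, RicciQuery.wDeg (RicciQuery.hWeight G u v) x 1 ≤ d) →
        p.Approximates G u v T (1 + ε + δ)) ∧
    -- part (ii)
    (∃ (T : ℕ) (p : RicciQuery.Prog),
      ∀ (V : Type w) [Fintype V] [DecidableEq V] (G : SimpleGraph V) [DecidableRel G.Adj]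
        (u v : V), G.Adj u v → G.degree u ≤ G.degree v →
        (1 - δ / 3) * (G.degree v : ℝ) ≤ (G.degree u : ℝ) →
        (∀ x, RicciQuery.wDeg (RicciQuery.hWeight G u v) x 1 ≤ d) →
        (∀ x, RicciQuery.wDeg (RicciQuery.hWeight G u v) x 2 ≤ d) →
        p.Approximates G u v T (1 / 2 + ε + δ)) := by
  refine ⟨fun j hj => ?_, ?_, ?_⟩
  · refine ⟨(d + 1) * d, RicciQuery.collect 0 j ((d + 1) * d) ∅ fun acc =>
      .output (.const acc.card), RicciQuery.collect_onlyWeight ?_ _ _, ?_⟩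
    · exact fun _ => trivial
    intro V _ _ G _ u v huv _ _ hd x
    have h := RicciQuery.wDeg_balancedWeight_le huv hj hd x
    exact ⟨h, RicciQuery.outputs_wDeg _ _ x h⟩
  -- For `s = 1` the constraint is tight, `2 - 1 = (3 - 1) / 2`, and all other weights are at least
  -- `K`. The loss is `3 - K = 1`.
  · obtain ⟨T, p, hp⟩ := RicciQuery.exists_approximates.{w} {1} (by simp) (K := 2) (c := 1 / 2)
      (by norm_num) (by norm_num) (by norm_num) (by norm_num) (by norm_num)
      (fun s hs h1 => by
        have : 2 ≤ s := by
          rw [Finset.mem_singleton] at hs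
          omega
        exact_mod_cast this) d hε hδ (r := 1 + ε + δ) (by linarith)
    exact ⟨T, p, fun V _ _ G _ u v huv hdeg hδdeg h1 =>
      hp V G u v huv hdeg hδdeg (by simpa using h1)⟩
  -- The remaining weights are at least 3 and have no gain, so here the error is even at most `ε +
  -- δ`.
  · obtain ⟨T, p, hp⟩ := RicciQuery.exists_approximates.{w} {1, 2} (by simp) (K := 3) (c := 1)
      (by norm_num) (by norm_num) (by norm_num) (by norm_num) (by norm_num)
      (fun s hs h1 => by
        have : 3 ≤ s := by
          rw [Finset.mem_insert, Finset.mem_singleton] at hs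
          omega
        exact_mod_cast this) d hε hδ (r := 1 / 2 + ε + δ) (by linarith)
    refine ⟨T, p, fun V _ _ G _ u v huv hdeg hδdeg h1 h2 => hp V G u v huv hdeg hδdeg ?_⟩
    intro s hs
    rw [Finset.mem_insert, Finset.mem_singleton] at hs
    rcases hs with rfl | rfl
    exacts [h1, h2]
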